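/- For a positive integer $c$, a finite simple graph is \emph{$c$-closed} if every two distinct nonadjacent vertices have at most $c-1$ common neighbors. An instance of \textsc{$c$-Closed Vertex Deletion} consists of a finite simple graph $G=(V,E)$ and a positive integer $k$; it is a yes-instance if there is a set $S\subseteq V$ with $|S|\le k$ such that $G-S$ is $c$-closed. Write $n=|V|$ and $m=|E|$. \textbf{Theorem.} For every constant $c\ge 2$, \textsc{$c$-Closed Vertex Deletion} parameterized by $k$ admits a kernel with $\mathcal{O}(k^{c+2})$ vertices that can be computed in $\mathcal{O}(n^3+n^2m)$ time. That is, for every integer $c\ge 2$ there are an algorithm and a constant $C$, both depending only on $c$, such that, given any instance $(G,k)$, the algorithm halts after at most $C\cdot(n^3+n^2m+1)$ steps and outputs an instance $(G',k')$ with $1\le k'\le k$ and $|V(G')|\le C\cdot k^{c+2}$ such that $(G,k)$ is a yes-instance if and only if $(G',k')$ is a yes-instance. Here an algorithm is a program of a word RAM with words of $\mathcal{O}(\log(n+k))$ bits (the hidden constant depending only on $c$), whose memory is zero outside the input at the start; each arithmetic operation, test and memory access is one step. Input and output graphs are given by the number of vertices and a list of the edges, each edge once, in arbitrary order. -/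

import Mathlib

/-! ## `c`-closed graphs and `c`-Closed Vertex Deletion -/

namespace CVD

/-- A (finite) graph is `c`-closed, for a positive integer `c`, if every two distinct nonadjacent
vertices have at most `c - 1` common neighbors. -/
def IsClosed {V : Type*} [Finite V] (c : ℕ) (G : SimpleGraph V) : Prop :=
  ∀ u v : V, u ≠ v → ¬ G.Adj u v → (G.commonNeighbors u v).ncard ≤ c - 1

/-- `(G, k)` is a yes-instance of `c`-Closed Vertex Deletion: there is a vertex set `S` with
`|S| ≤ k` such that `G - S`, the subgraph induced by the vertices outside `S`, is `c`-closed. -/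
def IsYes {V : Type*} [Finite V] (c : ℕ) (G : SimpleGraph V) (k : ℕ) : Prop :=
  ∃ S : Finset V, S.card ≤ k ∧ IsClosed c (G.induce {v | v ∉ S})

/-- `l` lists the edges of `G`, each exactly once, in any order and with any orientation. -/
def IsEdgeList {n : ℕ} (G : SimpleGraph (Fin n)) (l : List (Fin n × Fin n)) : Prop :=
  (l.map fun e => s(e.1, e.2)).Nodup ∧
    ∀ u v : Fin n, s(u, v) ∈ l.map (fun e => s(e.1, e.2)) ↔ G.Adj u v

/-- The instance with vertices `0, …, n - 1`, parameter `k` and edge list `l`, written as the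
sequence of words `n, k, m, u₁, v₁, …, uₘ, vₘ`. -/
def encode (n k : ℕ) (l : List (Fin n × Fin n)) : List ℕ :=
  n :: k :: l.length :: l.flatMap fun e => [(e.1 : ℕ), (e.2 : ℕ)]

end CVD

/-! ## A word RAM with a step count -/

namespace WordRAM

/-- The memory: scalar registers `R_i`, and arrays `A_a` of unbounded length. -/
structure State where
  reg : ℕ → ℕ
  arr : ℕ → ℕ → ℕ

/-- Write `x` to register `R_i`. -/
def State.setReg (s : State) (i x : ℕ) : State :=
  { s with reg := Function.update s.reg i x }

/-- Write `x` to cell `j` of array `A_a`. -/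
def State.setArr (s : State) (a j x : ℕ) : State :=
  { s with arr := Function.update s.arr a (Function.update (s.arr a) j x) }

/-- The arithmetic operations of the machine. -/
inductive Op where
  | add | sub | mul | div

/-- The value of an arithmetic operation (subtraction is truncated at `0`, division rounds down). -/
def Op.eval : Op → ℕ → ℕ → ℕ
  | .add, x, y => x + y
  | .sub, x, y => x - y
  | .mul, x, y => x * y
  | .div, x, y => x / y

/-- Elementary instructions. The register numbers, array names and constants are part of the
program text.
* `const i x`: `R_i := x`
* `arith o i j l`: `R_i := R_j o R_l`
* `load i a j`: `R_i := A_a[R_j]`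
* `store a j i`: `A_a[R_j] := R_i` -/
inductive Instr where
  | const (i x : ℕ)
  | arith (o : Op) (i j l : ℕ)
  | load (i a j : ℕ)
  | store (a j i : ℕ)

/-- The word that an instruction writes. -/
def Instr.value : Instr → State → ℕ
  | .const _ x, _ => x
  | .arith o _ j l, s => o.eval (s.reg j) (s.reg l)
  | .load _ a j, s => s.arr a (s.reg j)
  | .store _ _ i, s => s.reg i

/-- The state after an instruction. -/
def Instr.apply : Instr → State → State
  | .const i x, s => s.setReg i x
  | .arith o i j l, s => s.setReg i (o.eval (s.reg j) (s.reg l))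
  | .load i a j, s => s.setReg i (s.arr a (s.reg j))
  | .store a j i, s => s.setArr a (s.reg j) (s.reg i)

/-- Tests: `lt i j` is `R_i < R_j` and `eq i j` is `R_i = R_j`. -/
inductive Test where
  | lt (i j : ℕ)
  | eq (i j : ℕ)

/-- A test is satisfied in a state. -/
def Test.Holds : Test → State → Prop
  | .lt i j, s => s.reg i < s.reg j
  | .eq i j, s => s.reg i = s.reg j

/-- Programs. -/
inductive Prog where
  | skip
  | instr (I : Instr)
  | seq (P Q : Prog)
  | ite (b : Test) (P Q : Prog)
  | loop (b : Test) (P : Prog)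

/-- `Exec w P s s' t`: on a machine with words of `w` bits, the program `P` started in state `s`
halts in state `s'` after exactly `t` steps. Every instruction and every evaluation of a test is one
step. Each word written has to be smaller than `2 ^ w`: an execution that overflows gets stuck. -/
inductive Exec (w : ℕ) : Prog → State → State → ℕ → Prop
  | skip (s : State) : Exec w .skip s s 1
  | instr (I : Instr) (s : State) (h : I.value s < 2 ^ w) : Exec w (.instr I) s (I.apply s) 1
  | seq {P Q : Prog} {s s' s'' : State} {t t' : ℕ} (hP : Exec w P s s' t)
      (hQ : Exec w Q s' s'' t') : Exec w (.seq P Q) s s'' (t + t')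
  | ite_true {b : Test} {P Q : Prog} {s s' : State} {t : ℕ} (hb : b.Holds s)
      (hP : Exec w P s s' t) : Exec w (.ite b P Q) s s' (t + 1)
  | ite_false {b : Test} {P Q : Prog} {s s' : State} {t : ℕ} (hb : ¬ b.Holds s)
      (hQ : Exec w Q s s' t) : Exec w (.ite b P Q) s s' (t + 1)
  | loop_true {b : Test} {P : Prog} {s s' s'' : State} {t t' : ℕ} (hb : b.Holds s)
      (hP : Exec w P s s' t) (hL : Exec w (.loop b P) s' s'' t') :
      Exec w (.loop b P) s s'' (t + t' + 1)
  | loop_false {b : Test} {P : Prog} {s : State} (hb : ¬ b.Holds s) :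
      Exec w (.loop b P) s s 1

/-- The initial state: the input is in array `A_0`, and everything else is `0`. -/
def State.init (x : List ℕ) : State where
  reg := fun _ => 0
  arr := fun a i => if a = 0 then x.getD i 0 else 0

/-- The output is the sequence `y`: it stands at the beginning of array `A_1`. -/
def State.Outputs (s : State) (y : List ℕ) : Prop :=
  ∀ (i : ℕ) (h : i < y.length), s.arr 1 i = y[i]

end WordRAM

namespace CVD

/-- The program `P`, run with words of `a * Nat.size (n + k) = Θ(log (n + k))` bits, is a
kernelization for `c`-Closed Vertex Deletion parameterized by `k`: on every instance `(G, k)` with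
`n` vertices and `m` edges it halts after at most `time n m` steps, and its output is an equivalent
instance `(G', k')` with at most `size k` vertices and `k' ≤ k`. -/
def IsKernelization (c : ℕ) (P : WordRAM.Prog) (a : ℕ) (size : ℕ → ℕ) (time : ℕ → ℕ → ℕ) : Prop :=
  ∀ (n : ℕ) (G : SimpleGraph (Fin n)) (k : ℕ) (l : List (Fin n × Fin n)),
    1 ≤ k → IsEdgeList G l →
    ∃ (s : WordRAM.State) (t : ℕ),
      WordRAM.Exec (a * Nat.size (n + k)) P (WordRAM.State.init (encode n k l)) s t ∧
      t ≤ time n G.edgeSet.ncard ∧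
      ∃ (n' : ℕ) (G' : SimpleGraph (Fin n')) (k' : ℕ) (l' : List (Fin n' × Fin n')),
        1 ≤ k' ∧ IsEdgeList G' l' ∧ s.Outputs (encode n' k' l') ∧
        (IsYes c G k ↔ IsYes c G' k') ∧ n' ≤ size k ∧ k' ≤ k

end CVD

/-! Put `d = c + 2`. An obstruction to `c`-closedness is a `d`-tuple: two distinct nonadjacent
vertices and `c` distinct common neighbors. A solution is exactly a vertex set that hits all these
tuples, so the task is to kernelize a hitting set problem for sets of bounded size.

With `T = d * k + 1`, a family `K` of obstructions is built greedily. A new tuple `x` is rejected if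
it is already `Saturated`: for some set `B` of positions, at least `T ^ (d - |B|)` tuples of `K`
agree with `x` on `B`. The family therefore stays `Sparse`, meaning that no such count exceeds its
threshold. The case `B = ∅` gives `|K| ≤ T ^ d`, which is `O(k ^ (c + 2))`. Rejection is harmless by
`Sparse.hits_of_saturated`. Suppose that `S`, with `|S| ≤ k`, hits `K` but misses `x`. Every tuple
agreeing with `x` on `B` is then hit at a position outside `B`. There are at most `d * k < T`
choices of position and vertex, and each accounts for at most `T ^ (d - |B| - 1)` tuples, which is
too few in total.

Not all obstructions have to be inspected. For a nonadjacent pair, `c + k` common neighbors suffice,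
since `c` of them survive the deletion of any `k` vertices; and each choice of `c` neighbors is
needed only in increasing order. This is `PairDone`. Hence every solution of size at most `k` of the
subgraph induced by the vertices of `K` is a solution of `G` (`isSolution_of_pairDone`,
`isYes_comap_iff`), and `k` is unchanged.

For the running time, each of the fewer than `n ^ 2` pairs costs `O(n)` for its common neighbors and
a constant for each of at most `(c + k) ^ c` tuples. The constant is possible because the counts for
all `2 ^ d` sets `B` are kept in an array addressed by the partial tuple itself, which needs no
initialization in zeroed memory. If `(c + k) ^ c < n`, the total is `O(n ^ 3)`. Otherwise `n ≤ (c +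
k) ^ c` and the input is already a kernel, so it is copied (`kernel_spec`). The rest is program
verification: a total-correctness predicate `WP` with step bounds, a rule for counting loops
(`WP.forLoop`), and the fact that all numbers are polynomial in `n + k` and fit into words of the
allowed length (`exists_fits`). -/

namespace CVD

/-! ### Sparse families of tuples and their small hitting sets -/

section Hitting

variable {ι V : Type*} [Fintype ι] [DecidableEq ι] [DecidableEq V]

/-- The number of tuples in `K` that agree with `x` on the positions in `B`. -/
def agreeCount (K : Finset (ι → V)) (B : Finset ι) (x : ι → V) : ℕ :=
  (K.filter fun y => ∀ i ∈ B, y i = x i).card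

/-- No partial tuple extends to too many tuples in `K`. -/
def Sparse (T : ℕ) (K : Finset (ι → V)) : Prop :=
  ∀ (B : Finset ι) (x : ι → V), agreeCount K B x ≤ T ^ (Fintype.card ι - B.card)

/-- Some part of `x` extends to the largest admissible number of tuples in `K`. -/
def Saturated (T : ℕ) (K : Finset (ι → V)) (x : ι → V) : Prop :=
  ∃ B : Finset ι, T ^ (Fintype.card ι - B.card) ≤ agreeCount K B x

theorem agreeCount_mono {K K' : Finset (ι → V)} (h : K ⊆ K') (B : Finset ι) (x : ι → V) :
    agreeCount K B x ≤ agreeCount K' B x :=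
  Finset.card_le_card (Finset.filter_subset_filter _ h)

theorem Saturated.mono {T : ℕ} {K K' : Finset (ι → V)} {x : ι → V} (h : Saturated T K x)
    (hK : K ⊆ K') : Saturated T K' x :=
  h.imp fun B hB => hB.trans (agreeCount_mono hK B x)

/-- When `B` consists of all positions the threshold is `T ^ 0 = 1`, and `x` itself is counted. Thus
a stored tuple is never stored again. -/
theorem saturated_of_mem {T : ℕ} {K : Finset (ι → V)} {x : ι → V} (h : x ∈ K) :
    Saturated T K x := by
  refine ⟨Finset.univ, ?_⟩
  have : 0 < agreeCount K Finset.univ x := Finset.card_pos.2 ⟨x, by simp [h]⟩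
  simpa [Finset.card_univ, Nat.one_le_iff_ne_zero, Nat.pos_iff_ne_zero] using this

theorem agreeCount_insert {K : Finset (ι → V)} {x : ι → V} (hx : x ∉ K) (B : Finset ι)
    (y : ι → V) :
    agreeCount (insert x K) B y = agreeCount K B y + if ∀ i ∈ B, x i = y i then 1 else 0 := by
  unfold agreeCount
  rw [Finset.filter_insert]
  split_ifs with h
  · rw [Finset.card_insert_of_notMem (by simp [hx])]
  · simp

theorem agreeCount_congr {K : Finset (ι → V)} {B : Finset ι} {x y : ι → V}
    (h : ∀ i ∈ B, x i = y i) : agreeCount K B x = agreeCount K B y := by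
  unfold agreeCount
  congr 1
  refine Finset.filter_congr fun z _ => ?_
  exact forall₂_congr fun i hi => by rw [h i hi]

theorem sparse_empty (T : ℕ) : Sparse T (∅ : Finset (ι → V)) := fun B x => by simp [agreeCount]

/-- Only counts at pairs `(B, y)` where `y` agrees with `x` on `B` increase. Such a count equals the
one at `(B, x)`, which was strictly below its threshold. -/
theorem Sparse.insert_of_not_saturated {T : ℕ} {K : Finset (ι → V)} {x : ι → V} (h : Sparse T K)
    (hx : ¬ Saturated T K x) : Sparse T (insert x K) := by
  intro B y
  rw [agreeCount_insert fun h => hx (saturated_of_mem h)]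
  split_ifs with hxy
  · rw [← agreeCount_congr hxy]
    simp only [Saturated, not_exists, not_le] at hx
    exact hx B
  · exact h B y

theorem Sparse.card_le {T : ℕ} {K : Finset (ι → V)} (h : Sparse T K) :
    K.card ≤ T ^ Fintype.card ι := by
  rcases K.eq_empty_or_nonempty with rfl | ⟨x, _⟩
  · simp
  · simpa [agreeCount] using h ∅ x

/-- A small hitting set of a sparse family of tuples hits every saturated tuple. -/
theorem Sparse.hits_of_saturated {k : ℕ} {K : Finset (ι → V)}
    (h : Sparse (Fintype.card ι * k + 1) K) {S : Finset V} (hS : S.card ≤ k)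
    (hit : ∀ y ∈ K, ∃ i, y i ∈ S) {x : ι → V} (hx : Saturated (Fintype.card ι * k + 1) K x) :
    ∃ i, x i ∈ S := by
  obtain ⟨B, hB⟩ := hx
  by_contra! hxS
  set T := Fintype.card ι * k + 1 with hT
  -- A tuple agreeing with `x` on `B` cannot be hit inside `B`, since `x` avoids `S`. It is
  -- therefore covered by a position outside `B` together with the element of `S` found there.
  have hsub : (K.filter fun y => ∀ i ∈ B, y i = x i) ⊆
      (Bᶜ ×ˢ S).biUnion fun p =>
        K.filter fun y => ∀ i ∈ insert p.1 B, y i = Function.update x p.1 p.2 i := by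
    intro y hy
    rw [Finset.mem_filter] at hy
    obtain ⟨i, hi⟩ := hit y hy.1
    have hiB : i ∉ B := fun hiB => hxS i (hy.2 i hiB ▸ hi)
    simp only [Finset.mem_biUnion, Finset.mem_product, Finset.mem_compl, Finset.mem_filter]
    refine ⟨(i, y i), ⟨hiB, hi⟩, hy.1, fun j hj => ?_⟩
    rcases Finset.mem_insert.1 hj with rfl | hjB
    · simp
    · rw [Function.update_of_ne (by rintro rfl; exact hiB hjB), hy.2 j hjB]
  have hpos : 0 < T ^ (Fintype.card ι - B.card) := by positivity
  -- If `B` contained every position, the covering above would be empty although the covered set is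
  -- not.
  have hlt : B.card < Fintype.card ι := by
    obtain ⟨y, hy⟩ := Finset.card_pos.1 (hpos.trans_le hB)
    obtain ⟨p, hp, -⟩ := Finset.mem_biUnion.1 (hsub hy)
    refine Finset.card_lt_univ_of_notMem (x := p.1) ?_
    exact Finset.mem_compl.1 (Finset.mem_product.1 hp).1
  have hle : agreeCount K B x ≤ (Bᶜ ×ˢ S).card * T ^ (Fintype.card ι - B.card - 1) := by
    refine (Finset.card_le_card hsub).trans (Finset.card_biUnion_le_card_mul _ _ _ fun p hp => ?_)
    have hpB := Finset.mem_compl.1 (Finset.mem_product.1 hp).1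
    have := h (insert p.1 B) (Function.update x p.1 p.2)
    rwa [Finset.card_insert_of_notMem hpB, ← Nat.sub_sub] at this
  -- This is what `T` is chosen for: it exceeds the number of pairs of a position and an element of
  -- `S`.
  have hcard : (Bᶜ ×ˢ S).card < T := by
    rw [Finset.card_product, hT, Nat.lt_succ_iff]
    exact Nat.mul_le_mul (Finset.card_le_univ _) hS
  have hpow : T ^ (Fintype.card ι - B.card) = T * T ^ (Fintype.card ι - B.card - 1) := by
    rw [← pow_succ', Nat.sub_add_cancel (by omega)]
  have : 0 < T ^ (Fintype.card ι - B.card - 1) := by positivity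
  have := Nat.mul_lt_mul_of_pos_right hcard this
  omega

end Hitting

/-! ### Solutions as hitting sets of obstructions, and the induced instance -/

section Graph

variable {V : Type*}

/-- `S` meets every obstruction to `c`-closedness. -/
def IsSolution (c : ℕ) (G : SimpleGraph V) (S : Finset V) : Prop :=
  ∀ u v : V, u ∉ S → v ∉ S → u ≠ v → ¬ G.Adj u v → (G.commonNeighbors u v \ S).ncard ≤ c - 1

/-- Common neighbors in the induced subgraph correspond, under the inclusion, to common neighbors in
`G` outside `S`. This removes the subtype from all later arguments. -/
theorem isClosed_induce_iff [Finite V] (c : ℕ) (G : SimpleGraph V) (S : Finset V) :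
    IsClosed c (G.induce {v | v ∉ S}) ↔ IsSolution c G S := by
  have key : ∀ u v : {v | v ∉ S}, ((G.induce {v | v ∉ S}).commonNeighbors u v).ncard =
      (G.commonNeighbors u v \ S).ncard := by
    intro u v
    rw [← Set.ncard_image_of_injective _ Subtype.val_injective]
    congr 1
    ext w
    simp only [SimpleGraph.mem_commonNeighbors, Set.mem_image, Set.mem_sdiff]
    constructor
    · rintro ⟨w, h, rfl⟩
      exact ⟨h, w.2⟩
    · rintro ⟨h, hw⟩
      exact ⟨⟨w, hw⟩, h, rfl⟩
  simp only [IsClosed, IsSolution]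
  constructor
  · intro h u v hu hv huv hadj
    have := h ⟨u, hu⟩ ⟨v, hv⟩ (by simpa using huv) (by simpa using hadj)
    rwa [key] at this
  · intro h u v huv hadj
    rw [key]
    exact h u v u.2 v.2 (fun h => huv (Subtype.ext h)) (by simpa using hadj)

theorem isYes_iff [Finite V] (c : ℕ) (G : SimpleGraph V) (k : ℕ) :
    IsYes c G k ↔ ∃ S : Finset V, S.card ≤ k ∧ IsSolution c G S := by
  simp only [IsYes, isClosed_induce_iff]

/-- The tuple `(u, v, w₀, …)` is an obstruction to `c`-closedness: `u` and `v` are distinct,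
nonadjacent, and the distinct vertices `w₀, …` are common neighbors of them. -/
structure Forbidden {c : ℕ} (G : SimpleGraph V) (x : Fin (c + 2) → V) : Prop where
  ne : x 0 ≠ x 1
  not_adj : ¬ G.Adj (x 0) (x 1)
  inj : Function.Injective fun i : Fin c => x i.succ.succ
  mem : ∀ i : Fin c, x i.succ.succ ∈ G.commonNeighbors (x 0) (x 1)

/-- An obstruction avoiding `S` would exhibit `c` common neighbors outside `S`, one more than the `c
- 1` allowed; this is where `c` must be positive. -/
theorem IsSolution.hits [Finite V] {c : ℕ} (hc : 0 < c) {G : SimpleGraph V} {S : Finset V}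
    (h : IsSolution c G S) {x : Fin (c + 2) → V} (hx : Forbidden G x) : ∃ i, x i ∈ S := by
  by_contra! hS
  have h1 := h _ _ (hS 0) (hS 1) hx.ne hx.not_adj
  have h2 : (Set.range fun i : Fin c => x i.succ.succ) ⊆ G.commonNeighbors (x 0) (x 1) \ S := by
    rintro _ ⟨i, rfl⟩
    exact ⟨hx.mem i, hS _⟩
  have h3 := Set.ncard_le_ncard h2 (Set.toFinite _)
  rw [← Set.image_univ, Set.ncard_image_of_injective _ hx.inj, Set.ncard_univ, Nat.card_fin] at h3
  omega

/-- Being `c`-closed is hereditary: passing to an induced subgraph can only remove common neighbors.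
-/
theorem IsSolution.comap [Finite V] {c : ℕ} {G : SimpleGraph V} {S : Finset V} (h : IsSolution c G S)
    {W : Type*} [Finite W] (e : W ↪ V) :
    IsSolution c (G.comap e) (S.preimage e e.injective.injOn) := by
  intro u v hu hv huv hadj
  refine le_trans ?_ (h (e u) (e v) (by simpa using hu) (by simpa using hv)
    (e.injective.ne huv) hadj)
  rw [← Set.ncard_image_of_injective _ e.injective]
  refine Set.ncard_le_ncard ?_ (Set.toFinite _)
  rintro _ ⟨w, hw, rfl⟩
  simpa [SimpleGraph.mem_commonNeighbors] using hw

/-- The obstructions of the pair `u`, `v` are represented in `K`: there are enough common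
neighbors of `u` and `v` such that all obstructions formed with these are saturated. -/
def PairDone [DecidableEq V] [LT V] (c k : ℕ) (G : SimpleGraph V) (K : Finset (Fin (c + 2) → V))
    (u v : V) : Prop :=
  ∃ W : Finset V, (G.commonNeighbors u v ⊆ W ∨ (c + k ≤ W.card ∧ ↑W ⊆ G.commonNeighbors u v)) ∧
    ∀ g : Fin c → V, (∀ i j, i < j → g i < g j) → (∀ i, g i ∈ W) →
      Saturated ((c + 2) * k + 1) K (Fin.cons u (Fin.cons v g))

theorem PairDone.mono [DecidableEq V] [LT V] {c k : ℕ} {G : SimpleGraph V}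
    {K K' : Finset (Fin (c + 2) → V)} {u v : V} (h : PairDone c k G K u v) (hK : K ⊆ K') :
    PairDone c k G K' u v :=
  h.imp fun _ hW => ⟨hW.1, fun g hg hgW => (hW.2 g hg hgW).mono hK⟩

/-- A violated pair outside `S` would have `c` surviving common neighbors inside the set `W` of
`PairDone`. Listed increasingly, they form a saturated tuple that misses `S`, against
`Sparse.hits_of_saturated`. Symmetry of the pair reduces everything to `v < u`. -/
theorem isSolution_of_pairDone [Finite V] [LinearOrder V] {c k : ℕ} (hc : 0 < c) {G : SimpleGraph V}
    {K : Finset (Fin (c + 2) → V)} (hK : Sparse ((c + 2) * k + 1) K)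
    (hpairs : ∀ u v, v < u → ¬ G.Adj u v → PairDone c k G K u v)
    {S : Finset V} (hS : S.card ≤ k) (hit : ∀ x ∈ K, ∃ i, x i ∈ S) : IsSolution c G S := by
  have main : ∀ u v, v < u → u ∉ S → v ∉ S → ¬ G.Adj u v →
      (G.commonNeighbors u v \ S).ncard ≤ c - 1 := by
    intro u v hvu hu hv hadj
    obtain ⟨W, hW, hsat⟩ := hpairs u v hvu hadj
    by_contra! hlt
    -- Either `W` contains all common neighbors, including the `c` that survive, or it has at least
    -- `c + k` elements, of which `S` removes at most `k`.
    have hcard : c ≤ (W \ S).card := by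
      rcases hW with hW | hW
      · have : (G.commonNeighbors u v \ S).ncard ≤ (W \ S).card := by
          rw [← Set.ncard_coe_finset, Finset.coe_sdiff]
          exact Set.ncard_le_ncard (Set.sdiff_subset_sdiff_left hW) (Set.toFinite _)
        omega
      · have := Finset.le_card_sdiff S W
        omega
    obtain ⟨D, hD, hDc⟩ := Finset.exists_subset_card_eq hcard
    have hg : ∀ i, D.orderEmbOfFin hDc i ∈ W \ S := fun i => hD (D.orderEmbOfFin_mem hDc i)
    obtain ⟨i, hi⟩ := (show Sparse (Fintype.card (Fin (c + 2)) * k + 1) K by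
      simpa using hK).hits_of_saturated hS hit (x := Fin.cons u (Fin.cons v (D.orderEmbOfFin hDc)))
      (by
        rw [Fintype.card_fin]
        exact hsat _ (fun i j hij => (D.orderEmbOfFin hDc).strictMono hij)
          (fun i => (Finset.mem_sdiff.1 (hg i)).1))
    induction i using Fin.cases with
    | zero => exact hu hi
    | succ i =>
      induction i using Fin.cases with
      | zero => exact hv hi
      | succ i => exact (Finset.mem_sdiff.1 (hg i)).2 hi
  intro u v hu hv huv hadj
  rcases lt_or_gt_of_ne huv with h | h
  · rw [SimpleGraph.commonNeighbors_symm]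
    exact main v u h hv hu fun h => hadj h.symm
  · exact main u v h hu hv hadj

/-- Restricting the graph to the vertices of `K` yields an equivalent instance. -/
theorem isYes_comap_iff [Finite V] [LinearOrder V] {c k : ℕ} (hc : 0 < c) {G : SimpleGraph V}
    {K : Finset (Fin (c + 2) → V)} (hK : Sparse ((c + 2) * k + 1) K)
    (hforb : ∀ x ∈ K, Forbidden G x)
    (hpairs : ∀ u v, v < u → ¬ G.Adj u v → PairDone c k G K u v)
    {W : Type*} [Finite W] (e : W ↪ V) (he : ∀ x ∈ K, ∀ i, ∃ w, e w = x i) :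
    IsYes c G k ↔ IsYes c (G.comap e) k := by
  rw [isYes_iff, isYes_iff]
  constructor
  · rintro ⟨S, hS, h⟩
    refine ⟨_, ?_, h.comap e⟩
    exact (Finset.card_le_card_of_injOn e (fun w hw => by simpa using hw)
      e.injective.injOn).trans hS
  · rintro ⟨S, hS, h⟩
    refine ⟨S.map e, by simpa using hS, isSolution_of_pairDone hc hK hpairs (by simpa using hS) ?_⟩
    -- All vertices of a stored tuple lie in the image of `e`, so the tuple pulls back to an
    -- obstruction of the smaller graph and is hit there.
    intro x hx
    choose y hy using he x hx
    have hf := hforb x hx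
    obtain ⟨i, hi⟩ := h.hits (x := y) hc
      { ne := fun h => hf.ne (by rw [← hy, ← hy, h])
        not_adj := by simpa [hy] using hf.not_adj
        inj := fun i j hij => hf.inj (by simp only [← hy]; exact congrArg e hij)
        mem := by simpa [SimpleGraph.mem_commonNeighbors, hy] using hf.mem }
    exact ⟨i, by rw [← hy]; exact Finset.mem_map_of_mem e hi⟩

end Graph

end CVD

/-! ### A calculus of total correctness with step bounds for the word RAM -/

namespace WordRAM

/-- The instruction leaves register `i` unchanged. -/
def Instr.KeepsReg (i : ℕ) : Instr → Prop
  | .const j _ | .arith _ j _ _ | .load j _ _ => i ≠ j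
  | .store _ _ _ => True

/-- The instruction leaves array `a` unchanged. -/
def Instr.KeepsArr (a : ℕ) : Instr → Prop
  | .store b _ _ => a ≠ b
  | _ => True

/-- The program contains no instruction that writes to register `i`. -/
def Prog.KeepsReg (i : ℕ) : Prog → Prop
  | .skip => True
  | .instr I => I.KeepsReg i
  | .seq P Q | .ite _ P Q => P.KeepsReg i ∧ Q.KeepsReg i
  | .loop _ P => P.KeepsReg i

/-- The program contains no instruction that writes to array `a`. -/
def Prog.KeepsArr (a : ℕ) : Prog → Prop
  | .skip => True
  | .instr I => I.KeepsArr a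
  | .seq P Q | .ite _ P Q => P.KeepsArr a ∧ Q.KeepsArr a
  | .loop _ P => P.KeepsArr a

theorem Instr.KeepsReg.apply {i : ℕ} {I : Instr} (h : I.KeepsReg i) (s : State) :
    (I.apply s).reg i = s.reg i := by
  cases I <;> simp_all [Instr.KeepsReg, Instr.apply, State.setReg, State.setArr]

theorem Instr.KeepsArr.apply {a : ℕ} {I : Instr} (h : I.KeepsArr a) (s : State) :
    (I.apply s).arr a = s.arr a := by
  cases I <;> simp_all [Instr.KeepsArr, Instr.apply, State.setReg, State.setArr]

theorem Exec.reg_eq {w : ℕ} {P : Prog} {s s' : State} {t i : ℕ} (h : Exec w P s s' t)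
    (hP : P.KeepsReg i) : s'.reg i = s.reg i := by
  induction h with
  | skip => rfl
  | instr I s => exact Instr.KeepsReg.apply hP s
  | seq _ _ ih1 ih2 => exact (ih2 hP.2).trans (ih1 hP.1)
  | ite_true _ _ ih => exact ih hP.1
  | ite_false _ _ ih => exact ih hP.2
  | loop_true _ _ _ ih1 ih2 => exact (ih2 hP).trans (ih1 hP)
  | loop_false => rfl

theorem Exec.arr_eq {w : ℕ} {P : Prog} {s s' : State} {t a : ℕ} (h : Exec w P s s' t)
    (hP : P.KeepsArr a) : s'.arr a = s.arr a := by
  induction h with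
  | skip => rfl
  | instr I s => exact Instr.KeepsArr.apply hP s
  | seq _ _ ih1 ih2 => exact (ih2 hP.2).trans (ih1 hP.1)
  | ite_true _ _ ih => exact ih hP.1
  | ite_false _ _ ih => exact ih hP.2
  | loop_true _ _ _ ih1 ih2 => exact (ih2 hP).trans (ih1 hP)
  | loop_false => rfl

/-- Total correctness with a time bound: started in `s`, the program `P` halts within `T` steps in
a state that satisfies `Q`. -/
def WP (w : ℕ) (P : Prog) (s : State) (T : ℕ) (Q : State → Prop) : Prop :=
  ∃ s' t, Exec w P s s' t ∧ t ≤ T ∧ Q s'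

variable {w : ℕ}

theorem WP.mono {P : Prog} {s : State} {T T' : ℕ} {Q Q' : State → Prop} (h : WP w P s T Q)
    (hT : T ≤ T') (hQ : ∀ s', Q s' → Q' s') : WP w P s T' Q' :=
  let ⟨s', t, he, ht, hq⟩ := h
  ⟨s', t, he, ht.trans hT, hQ s' hq⟩

/-- Adds to any specification, for free, that registers and arrays not syntactically written are
unchanged, so specifications need to mention only what a program computes. -/
theorem WP.frame {P : Prog} {s : State} {T : ℕ} {Q : State → Prop} (h : WP w P s T Q) :
    WP w P s T fun s' => Q s' ∧ (∀ i, P.KeepsReg i → s'.reg i = s.reg i) ∧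
      ∀ a, P.KeepsArr a → s'.arr a = s.arr a :=
  let ⟨s', t, he, ht, hq⟩ := h
  ⟨s', t, he, ht, hq, fun _ => he.reg_eq, fun _ => he.arr_eq⟩

theorem WP.skip {s : State} {Q : State → Prop} (h : Q s) : WP w .skip s 1 Q :=
  ⟨s, 1, .skip s, le_rfl, h⟩

theorem WP.seq {P P' : Prog} {s : State} {T T' : ℕ} {Q : State → Prop}
    (h : WP w P s T fun s' => WP w P' s' T' Q) : WP w (.seq P P') s (T + T') Q :=
  let ⟨_, _, he, ht, s'', _, he', ht', hq⟩ := h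
  ⟨s'', _, he.seq he', Nat.add_le_add ht ht', hq⟩

theorem WP.ite {b : Test} {P P' : Prog} {s : State} {T : ℕ} {Q : State → Prop}
    (h : b.Holds s → WP w P s T Q) (h' : ¬ b.Holds s → WP w P' s T Q) :
    WP w (.ite b P P') s (T + 1) Q := by
  by_cases hb : b.Holds s
  · obtain ⟨s', t, he, ht, hq⟩ := h hb
    exact ⟨s', _, .ite_true hb he, Nat.succ_le_succ ht, hq⟩
  · obtain ⟨s', t, he, ht, hq⟩ := h' hb
    exact ⟨s', _, .ite_false hb he, Nat.succ_le_succ ht, hq⟩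

/-- Straight-line code. -/
def Prog.block (l : List Instr) : Prog :=
  l.foldr (fun I P => .seq (.instr I) P) .skip

/-- The state after straight-line code. -/
def runBlock (l : List Instr) (s : State) : State :=
  l.foldl (fun s I => I.apply s) s

/-- Straight-line code does not overflow. -/
def BlockOk (w : ℕ) : List Instr → State → Prop
  | [], _ => True
  | I :: l, s => I.value s < 2 ^ w ∧ BlockOk w l (I.apply s)

@[simp] theorem runBlock_nil (s : State) : runBlock [] s = s := rfl

@[simp] theorem runBlock_cons (I : Instr) (l : List Instr) (s : State) :
    runBlock (I :: l) s = runBlock l (I.apply s) := rfl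

theorem runBlock_append (l l' : List Instr) (s : State) :
    runBlock (l ++ l') s = runBlock l' (runBlock l s) := List.foldl_append

theorem blockOk_append (l l' : List Instr) (s : State) :
    BlockOk w (l ++ l') s ↔ BlockOk w l s ∧ BlockOk w l' (runBlock l s) := by
  induction l generalizing s with
  | nil => simp [BlockOk]
  | cons I l ih => simp [BlockOk, ih, and_assoc]

theorem WP.block {l : List Instr} {s : State} {Q : State → Prop} (h : BlockOk w l s)
    (hQ : Q (runBlock l s)) : WP w (.block l) s (l.length + 1) Q := by
  induction l generalizing s with
  | nil => exact WP.skip hQ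
  | cons I l ih =>
    obtain ⟨s', t, he, ht, hq⟩ := ih h.2 hQ
    refine ⟨s', _, .seq (.instr I s h.1) he, ?_, hq⟩
    simp only [List.length_cons]
    omega

theorem keepsReg_block {i : ℕ} {l : List Instr} :
    (Prog.block l).KeepsReg i ↔ ∀ I ∈ l, I.KeepsReg i := by
  induction l with
  | nil => simp [Prog.block, Prog.KeepsReg]
  | cons I l ih => simpa [Prog.block, Prog.KeepsReg] using fun _ => ih

theorem keepsArr_block {a : ℕ} {l : List Instr} :
    (Prog.block l).KeepsArr a ↔ ∀ I ∈ l, I.KeepsArr a := by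
  induction l with
  | nil => simp [Prog.block, Prog.KeepsArr]
  | cons I l ih => simpa [Prog.block, Prog.KeepsArr] using fun _ => ih

theorem runBlock_reg {i : ℕ} {l : List Instr} (h : ∀ I ∈ l, I.KeepsReg i) (s : State) :
    (runBlock l s).reg i = s.reg i := by
  induction l generalizing s with
  | nil => rfl
  | cons I l ih =>
    rw [runBlock_cons, ih fun J hJ => h J (List.mem_cons_of_mem _ hJ),
      (h I List.mem_cons_self).apply]

theorem runBlock_arr {a : ℕ} {l : List Instr} (h : ∀ I ∈ l, I.KeepsArr a) (s : State) :
    (runBlock l s).arr a = s.arr a := by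
  induction l generalizing s with
  | nil => rfl
  | cons I l ih =>
    rw [runBlock_cons, ih fun J hJ => h J (List.mem_cons_of_mem _ hJ),
      (h I List.mem_cons_self).apply]

/-- `for R_x := 0, …, R_b - 1 do P`, provided that `R_1` holds the constant `1` and that `P` writes
neither `R_x` nor `R_b` nor `R_1`. -/
def Prog.forLoop (x b : ℕ) (P : Prog) : Prog :=
  .seq (.instr (.const x 0)) (.loop (.lt x b) (.seq P (.instr (.arith .add x x 1))))

theorem keepsReg_forLoop {i x b : ℕ} {P : Prog} :
    (Prog.forLoop x b P).KeepsReg i ↔ i ≠ x ∧ P.KeepsReg i := by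
  simp only [Prog.forLoop, Prog.KeepsReg, Instr.KeepsReg]
  tauto

theorem keepsArr_forLoop {a x b : ℕ} {P : Prog} :
    (Prog.forLoop x b P).KeepsArr a ↔ P.KeepsArr a := by
  simp [Prog.forLoop, Prog.KeepsArr, Instr.KeepsArr]

/-- The invariant rule for counting loops. The frame conditions always compare with the state `s₀`
before the loop, so invariants describe only what changes. The invariant is re-established with the
counter already advanced. Each round adds one test and one increment to `T`; the final `2` pays for
the initialization and the failing test. -/
theorem WP.forLoop {x b N T : ℕ} {P : Prog} {s₀ : State} {Q : State → Prop}
    (I : ℕ → State → Prop) (hb : s₀.reg b = N) (h1 : s₀.reg 1 = 1) (hN : N < 2 ^ w)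
    (hxb : b ≠ x) (hx1 : 1 ≠ x) (kx : P.KeepsReg x) (kb : P.KeepsReg b) (k1 : P.KeepsReg 1)
    (init : I 0 (s₀.setReg x 0))
    (step : ∀ i s, i < N → s.reg x = i →
      (∀ j, j ≠ x → P.KeepsReg j → s.reg j = s₀.reg j) →
      (∀ a, P.KeepsArr a → s.arr a = s₀.arr a) → I i s →
      WP w P s T fun s' => I (i + 1) (s'.setReg x (i + 1)))
    (post : ∀ s, (∀ j, j ≠ x → P.KeepsReg j → s.reg j = s₀.reg j) →
      (∀ a, P.KeepsArr a → s.arr a = s₀.arr a) → I N s → Q s) :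
    WP w (.forLoop x b P) s₀ (N * (T + 2) + 2) Q := by
  -- Induction on the number `d` of remaining rounds.
  have main : ∀ d i s, N - i = d → i ≤ N → s.reg x = i →
      (∀ j, j ≠ x → P.KeepsReg j → s.reg j = s₀.reg j) →
      (∀ a, P.KeepsArr a → s.arr a = s₀.arr a) → I i s →
      WP w (.loop (.lt x b) (.seq P (.instr (.arith .add x x 1)))) s (d * (T + 2) + 1) Q := by
    intro d
    induction d with
    | zero =>
      intro i s hd hi hx hr ha hI
      obtain rfl : i = N := by omega
      refine ⟨s, 1, .loop_false ?_, by omega, post s hr ha hI⟩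
      simp [Test.Holds, hx, hr b hxb kb, hb]
    | succ d ih =>
      intro i s hd hi hx hr ha hI
      obtain ⟨s', t, he, ht, hI'⟩ := step i s (by omega) hx hr ha hI
      have hx' : s'.reg x = i := (he.reg_eq kx).trans hx
      have h1' : s'.reg 1 = 1 := by rw [he.reg_eq k1, hr 1 hx1 k1, h1]
      have hI2 : (Instr.arith .add x x 1).apply s' = s'.setReg x (i + 1) := by
        simp [Instr.apply, Op.eval, hx', h1']
      obtain ⟨s'', t', he', ht', hq⟩ := ih (i + 1) (s'.setReg x (i + 1)) (by omega) (by omega)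
        (by simp [State.setReg])
        (fun j hj kj => by simp [State.setReg, hj, he.reg_eq kj, hr j hj kj])
        (fun a ka => by simp [State.setReg, he.arr_eq ka, ha a ka]) hI'
      refine ⟨s'', t + 1 + t' + 1, .loop_true ?_ (.seq he ?_) he', ?_, hq⟩
      · simp only [Test.Holds, hx, hr b hxb kb, hb]
        omega
      · rw [← hI2]
        refine .instr _ _ ?_
        simp only [Instr.value, Op.eval, hx', h1']
        omega
      · rw [Nat.succ_mul]
        omega
  obtain ⟨s', t, he, ht, hq⟩ := main N 0 (s₀.setReg x 0) rfl (Nat.zero_le _)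
    (by simp [State.setReg]) (fun j hj _ => by simp [State.setReg, hj])
    (fun a _ => rfl) init
  refine ⟨s', _, .seq (.instr _ _ ?_) he, ?_, hq⟩
  · simp [Instr.value]
  · omega

end WordRAM

/-! ### Addresses of partial tuples, and branch-free code for the counters -/

namespace CVD

open WordRAM

/-- The number with the digits `x i + 1` (`i ∈ B`) and `0` (`i ∉ B`) in base `N`. -/
def address {d : ℕ} (N : ℕ) (B : Finset (Fin d)) (x : Fin d → ℕ) : ℕ :=
  (List.finRange d).foldl (fun a i => a * N + if i ∈ B then x i + 1 else 0) 0

/-- Uniqueness of digit expansions: the induction hypothesis identifies all later digits and the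
number before them, and division by `N` then splits off the current digit. -/
theorem foldl_digits_inj {ι : Type*} {N : ℕ} {f g : ι → ℕ} (hf : ∀ i, f i < N) (hg : ∀ i, g i < N)
    (l : List ι) (a b : ℕ)
    (h : l.foldl (fun a i => a * N + f i) a = l.foldl (fun a i => a * N + g i) b) :
    a = b ∧ ∀ i ∈ l, f i = g i := by
  induction l generalizing a b with
  | nil => exact ⟨h, by simp⟩
  | cons i l ih =>
    obtain ⟨h1, h2⟩ := ih _ _ h
    have hN : 0 < N := (Nat.zero_le _).trans_lt (hf i)
    have hab : a = b := by
      have := congrArg (· / N) h1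
      simpa [Nat.add_div_of_dvd_right, Nat.mul_div_cancel _ hN, Nat.div_eq_of_lt (hf i),
        Nat.div_eq_of_lt (hg i)] using this
    subst hab
    refine ⟨rfl, fun j hj => ?_⟩
    rcases List.mem_cons.1 hj with rfl | hj
    · simpa using h1
    · exact h2 j hj

/-- The digit `0` marks a position outside `B` and vertices are shifted by one. Hence the address
determines `B` and the entries on `B`, and nothing else, so distinct partial tuples never share a
counter. -/
theorem address_eq_iff {d n : ℕ} {B B' : Finset (Fin d)} {x y : Fin d → Fin n} :
    address (n + 1) B (fun i => x i) = address (n + 1) B' (fun i => y i) ↔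
      B = B' ∧ ∀ i ∈ B, x i = y i := by
  constructor
  · intro h
    have h2 := (foldl_digits_inj (N := n + 1) (f := fun i => if i ∈ B then (x i : ℕ) + 1 else 0)
      (g := fun i => if i ∈ B' then (y i : ℕ) + 1 else 0)
      (fun i => by split_ifs <;> omega) (fun i => by split_ifs <;> omega) _ _ _ h).2
    have h3 : ∀ i, (i ∈ B ↔ i ∈ B') ∧ (i ∈ B → x i = y i) := by
      intro i
      have := h2 i (List.mem_finRange i)
      by_cases hB : i ∈ B <;> by_cases hB' : i ∈ B' <;> simp [hB, hB'] at this ⊢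
      exact Fin.ext this
    exact ⟨Finset.ext fun i => (h3 i).1, fun i => (h3 i).2⟩
  · rintro ⟨rfl, h⟩
    unfold address
    congr 1
    funext a i
    by_cases hi : i ∈ B
    · simp [hi, h i hi]
    · simp [hi]

/-- The instructions that process position `i` in `maskCode`. -/
def maskStep {d : ℕ} (B : Finset (Fin d)) (i : Fin d) : List Instr :=
  .arith .mul 12 12 5 :: if i ∈ B then [.arith .add 13 (40 + i) 1, .arith .add 12 12 13]
    else [.arith .mul 14 14 6]

/-- Put the address of `B` and `x` into `R_12` and the threshold of `B` into `R_14`. -/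
def maskCode {d : ℕ} (B : Finset (Fin d)) : List Instr :=
  .const 12 0 :: .const 14 1 :: (List.finRange d).flatMap (maskStep B)

theorem maskStep_keepsReg {d : ℕ} {B : Finset (Fin d)} {i : Fin d} {j : ℕ} (h12 : j ≠ 12)
    (h13 : j ≠ 13) (h14 : j ≠ 14) : ∀ I ∈ maskStep B i, I.KeepsReg j := by
  unfold maskStep
  split_ifs <;> simp [Instr.KeepsReg, *]

theorem maskStep_keepsArr {d : ℕ} {B : Finset (Fin d)} {i : Fin d} {a : ℕ} :
    ∀ I ∈ maskStep B i, I.KeepsArr a := by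
  unfold maskStep
  split_ifs <;> simp [Instr.KeepsArr]

theorem maskCode_keepsReg {d : ℕ} {B : Finset (Fin d)} {j : ℕ} (h12 : j ≠ 12)
    (h13 : j ≠ 13) (h14 : j ≠ 14) : ∀ I ∈ maskCode B, I.KeepsReg j := by
  simp only [maskCode, List.mem_cons, List.mem_flatMap]
  rintro I (rfl | rfl | ⟨i, -, hi⟩)
  · exact h12
  · exact h14
  · exact maskStep_keepsReg h12 h13 h14 I hi

theorem maskCode_keepsArr {d : ℕ} {B : Finset (Fin d)} {a : ℕ} :
    ∀ I ∈ maskCode B, I.KeepsArr a := by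
  simp only [maskCode, List.mem_cons, List.mem_flatMap]
  rintro I (rfl | rfl | ⟨i, -, hi⟩)
  · trivial
  · trivial
  · exact maskStep_keepsArr I hi

/-- Stated for an arbitrary list of positions and arbitrary partial results, so that induction
applies. The bounds on `R_12` and `R_14` reserve room for all digits and factors still to come,
which rules out overflow. -/
theorem maskSteps_spec {w d n T : ℕ} (B : Finset (Fin d)) (x : Fin d → ℕ) (hx : ∀ i, x i < n)
    (hT : 0 < T) (l : List (Fin d)) (s : State) (h1 : s.reg 1 = 1) (h5 : s.reg 5 = n + 1)
    (h6 : s.reg 6 = T) (hX : ∀ i : Fin d, s.reg (40 + i) = x i) (hn : n + 1 < 2 ^ w)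
    (h12 : (s.reg 12 + 1) * (n + 1) ^ l.length ≤ 2 ^ w) (h14 : s.reg 14 * T ^ l.length < 2 ^ w) :
    BlockOk w (l.flatMap (maskStep B)) s ∧
    (runBlock (l.flatMap (maskStep B)) s).reg 12 =
      l.foldl (fun a i => a * (n + 1) + if i ∈ B then x i + 1 else 0) (s.reg 12) ∧
    (runBlock (l.flatMap (maskStep B)) s).reg 14 =
      s.reg 14 * T ^ l.countP (fun i => i ∉ B) := by
  induction l generalizing s with
  | nil => simp [BlockOk]
  | cons i l ih =>
    rw [List.flatMap_cons, blockOk_append, runBlock_append]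
    have hr : ∀ j, j ≠ 12 → j ≠ 13 → j ≠ 14 → (runBlock (maskStep B i) s).reg j = s.reg j :=
      fun j hj hj' hj'' => runBlock_reg (maskStep_keepsReg hj hj' hj'') s
    have hpos : 0 < (n + 1) ^ l.length := by positivity
    have hTpos : 0 < T ^ l.length := by positivity
    have hxi := hx i
    have hlt : ∀ y ≤ n, s.reg 12 * (n + 1) + y < 2 ^ w := by
      intro y hy
      refine lt_of_lt_of_le ?_ h12
      rw [List.length_cons, pow_succ, mul_comm ((n + 1) ^ _), ← mul_assoc]
      refine lt_of_lt_of_le ?_ (Nat.le_mul_of_pos_right _ hpos)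
      rw [Nat.succ_mul]
      omega
    have hlt' : s.reg 14 * T < 2 ^ w := by
      refine lt_of_le_of_lt ?_ h14
      rw [List.length_cons, pow_succ, mul_comm (T ^ _), ← mul_assoc]
      exact Nat.le_mul_of_pos_right _ hTpos
    have hle : s.reg 14 * T ^ l.length < 2 ^ w := by
      refine lt_of_le_of_lt ?_ h14
      rw [List.length_cons]
      exact Nat.mul_le_mul_left _ (Nat.pow_le_pow_right hT (Nat.le_succ _))
    have e12 : (runBlock (maskStep B i) s).reg 12 =
        s.reg 12 * (n + 1) + if i ∈ B then x i + 1 else 0 := by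
      have := hX i
      unfold maskStep
      split_ifs <;>
        simp [Instr.apply, State.setReg, Op.eval, h1, h5, this,
          show (40 + (i : ℕ)) ≠ 12 by omega]
    have e14 : (runBlock (maskStep B i) s).reg 14 = s.reg 14 * if i ∈ B then 1 else T := by
      unfold maskStep
      split_ifs <;> simp [Instr.apply, State.setReg, Op.eval, Function.update_apply, h6]
    -- A digit is at most `n`, so appending it preserves the reserved bound on `R_12`.
    have hle' : s.reg 12 * (n + 1) + (if i ∈ B then x i + 1 else 0) + 1 ≤
        (s.reg 12 + 1) * (n + 1) := by
      rw [Nat.succ_mul]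
      split_ifs <;> omega
    obtain ⟨ok, ih12, ih14⟩ := ih (runBlock (maskStep B i) s)
      (by rw [hr] <;> simp [h1]) (by rw [hr] <;> simp [h5]) (by rw [hr] <;> simp [h6])
      (fun j => by rw [hr] <;> [exact hX j; omega; omega; omega])
      (by
        rw [e12]
        refine le_trans (Nat.mul_le_mul_right _ hle') ?_
        rwa [List.length_cons, pow_succ', ← mul_assoc] at h12)
      (by
        rw [e14]
        split_ifs
        · simpa using hle
        · rwa [List.length_cons, pow_succ', ← mul_assoc] at h14)
    refine ⟨⟨?_, ok⟩, ?_, ?_⟩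
    · have h0 := hlt 0 (Nat.zero_le _)
      have h2 := hlt (x i + 1) hxi
      have := hX i
      unfold maskStep
      split_ifs <;>
        simp [BlockOk, Instr.value, Instr.apply, State.setReg, Op.eval, h1, h5, h6, this,
          show (40 + (i : ℕ)) ≠ 12 by omega] <;> omega
    · rw [ih12, e12, List.foldl_cons]
    · rw [ih14, e14, List.countP_cons]
      by_cases hi : i ∈ B
      · simp [hi]
      · simp [hi, pow_succ']
        ring

theorem countP_notMem {d : ℕ} (B : Finset (Fin d)) :
    (List.finRange d).countP (fun i => i ∉ B) = d - B.card := by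
  rw [List.countP_eq_length_filter, ← List.toFinset_card_of_nodup
    ((List.nodup_finRange d).filter _)]
  have : ((List.finRange d).filter fun i => decide (i ∉ B)).toFinset = Bᶜ := by
    ext i
    simp
  rw [this, Finset.card_compl, Fintype.card_fin]

/-- The registers and word length expected by the code that handles a tuple `x`. -/
structure TupleCtx {d : ℕ} (w n T : ℕ) (x : Fin d → ℕ) (s : State) : Prop where
  one : s.reg 1 = 1
  base : s.reg 5 = n + 1
  thr : s.reg 6 = T
  tuple : ∀ i : Fin d, s.reg (40 + i) = x i

theorem TupleCtx.congr {d w n T : ℕ} {x : Fin d → ℕ} {s s' : State} (h : TupleCtx w n T x s)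
    (hs : ∀ j, j ≠ 12 → j ≠ 13 → j ≠ 14 → j ≠ 19 → s'.reg j = s.reg j) : TupleCtx w n T x s' where
  one := (hs 1 (by simp) (by simp) (by simp) (by simp)).trans h.one
  base := (hs 5 (by simp) (by simp) (by simp) (by simp)).trans h.base
  thr := (hs 6 (by simp) (by simp) (by simp) (by simp)).trans h.thr
  tuple i := (hs _ (by omega) (by omega) (by omega) (by omega)).trans (h.tuple i)

theorem maskCode_spec {w d n T : ℕ} (B : Finset (Fin d)) {x : Fin d → ℕ} (hx : ∀ i, x i < n)
    (hT : 0 < T) {s : State} (h : TupleCtx w n T x s) (hn : n + 1 < 2 ^ w)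
    (hN : (n + 1) ^ d ≤ 2 ^ w) (hTd : T ^ d < 2 ^ w) :
    BlockOk w (maskCode B) s ∧
    (runBlock (maskCode B) s).reg 12 = address (n + 1) B x ∧
    (runBlock (maskCode B) s).reg 14 = T ^ (d - B.card) := by
  have := maskSteps_spec B x hx hT (List.finRange d) ((Instr.const 14 1).apply
    ((Instr.const 12 0).apply s)) (w := w)
    (by simp [Instr.apply, State.setReg, h.one])
    (by simp [Instr.apply, State.setReg, h.base])
    (by simp [Instr.apply, State.setReg, h.thr])
    (fun i => by simp [Instr.apply, State.setReg, h.tuple i,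
      show (40 + (i : ℕ)) ≠ 12 by omega, show (40 + (i : ℕ)) ≠ 14 by omega])
    hn (by simpa [Instr.apply, State.setReg] using hN)
    (by simpa [Instr.apply, State.setReg] using hTd)
  obtain ⟨ok, h12, h14⟩ := this
  refine ⟨⟨?_, ?_, ok⟩, ?_, ?_⟩
  · simp [Instr.value]
  · simp only [Instr.value]
    omega
  · exact h12.trans (by simp [Instr.apply, State.setReg, address])
  · rw [countP_notMem] at h14
    exact h14.trans (by simp [Instr.apply, State.setReg])

/-- Increase `R_19` if the counter of `B` and `x` has reached the threshold. -/
def checkStep {d : ℕ} (B : Finset (Fin d)) : List Instr :=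
  maskCode B ++ [.load 13 4 12, .arith .add 13 13 1, .arith .sub 13 13 14, .arith .add 19 19 13]

theorem checkStep_keepsReg {d : ℕ} {B : Finset (Fin d)} {j : ℕ} (h12 : j ≠ 12)
    (h13 : j ≠ 13) (h14 : j ≠ 14) (h19 : j ≠ 19) : ∀ I ∈ checkStep B, I.KeepsReg j := by
  exact List.forall_mem_append.2 ⟨maskCode_keepsReg h12 h13 h14, by simp [Instr.KeepsReg, *]⟩

theorem checkStep_keepsArr {d : ℕ} {B : Finset (Fin d)} {a : ℕ} :
    ∀ I ∈ checkStep B, I.KeepsArr a := by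
  exact List.forall_mem_append.2 ⟨maskCode_keepsArr, by simp [Instr.KeepsArr]⟩

/-- Since subtraction is truncated, counter plus one minus threshold is positive exactly when the
threshold has been reached. By `hc` it is at most `1`, so `R_19` grows by at most the number of sets
examined. -/
theorem check_spec {w d n T : ℕ} {x : Fin d → ℕ} (hx : ∀ i, x i < n)
    (hT : 0 < T) (hn : n + 1 < 2 ^ w) (hN : (n + 1) ^ d ≤ 2 ^ w) (hTd : T ^ d + 1 < 2 ^ w)
    (l : List (Finset (Fin d))) {s : State} (h : TupleCtx w n T x s)
    (hc : ∀ B, s.arr 4 (address (n + 1) B x) ≤ T ^ (d - B.card))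
    (h19 : s.reg 19 + l.length < 2 ^ w) :
    BlockOk w (l.flatMap checkStep) s ∧
    ((runBlock (l.flatMap checkStep) s).reg 19 = 0 ↔
      s.reg 19 = 0 ∧ ∀ B ∈ l, s.arr 4 (address (n + 1) B x) < T ^ (d - B.card)) := by
  induction l generalizing s with
  | nil => simp [BlockOk]
  | cons B l ih =>
    rw [List.flatMap_cons, blockOk_append, runBlock_append]
    obtain ⟨ok, e12, e14⟩ := maskCode_spec B hx hT h hn hN (by omega)
    have earr : (runBlock (maskCode B) s).arr 4 = s.arr 4 := runBlock_arr maskCode_keepsArr s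
    have e1 : (runBlock (maskCode B) s).reg 1 = 1 :=
      (runBlock_reg (maskCode_keepsReg (by simp) (by simp) (by simp)) s).trans h.one
    have e19 : (runBlock (maskCode B) s).reg 19 = s.reg 19 :=
      runBlock_reg (maskCode_keepsReg (by simp) (by simp) (by simp)) s
    have hle : T ^ (d - B.card) ≤ T ^ d := Nat.pow_le_pow_right hT (Nat.sub_le _ _)
    have hcB := hc B
    have f19 : (runBlock (checkStep B) s).reg 19 =
        s.reg 19 + (s.arr 4 (address (n + 1) B x) + 1 - T ^ (d - B.card)) := by
      rw [checkStep, runBlock_append]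
      simp [Instr.apply, State.setReg, Op.eval, e12, e14, earr, e1, e19]
    have farr : (runBlock (checkStep B) s).arr 4 = s.arr 4 := runBlock_arr checkStep_keepsArr s
    obtain ⟨ok', h'⟩ := ih (s := runBlock (checkStep B) s)
      (h.congr fun j h12 h13 h14 h19 => runBlock_reg (checkStep_keepsReg h12 h13 h14 h19) s)
      (by rwa [farr]) (by
        rw [f19]
        rw [List.length_cons] at h19
        omega)
    refine ⟨⟨?_, ok'⟩, ?_⟩
    · rw [checkStep, blockOk_append]
      refine ⟨ok, ?_⟩
      rw [List.length_cons] at h19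
      simp [BlockOk, Instr.value, Instr.apply, State.setReg, Op.eval, e12, e14, earr, e1, e19]
      omega
    · rw [h', f19, farr, List.forall_mem_cons]
      constructor
      · rintro ⟨h1, h2⟩
        exact ⟨by omega, by omega, h2⟩
      · rintro ⟨h1, h2, h3⟩
        exact ⟨by omega, h3⟩

/-- Increase the counter of `B` and `x`. -/
def countStep {d : ℕ} (B : Finset (Fin d)) : List Instr :=
  maskCode B ++ [.load 13 4 12, .arith .add 13 13 1, .store 4 12 13]

theorem countStep_keepsReg {d : ℕ} {B : Finset (Fin d)} {j : ℕ} (h12 : j ≠ 12)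
    (h13 : j ≠ 13) (h14 : j ≠ 14) : ∀ I ∈ countStep B, I.KeepsReg j := by
  exact List.forall_mem_append.2 ⟨maskCode_keepsReg h12 h13 h14, by simp [Instr.KeepsReg, *]⟩

theorem countStep_keepsArr {d : ℕ} {B : Finset (Fin d)} {a : ℕ} (ha : a ≠ 4) :
    ∀ I ∈ countStep B, I.KeepsArr a := by
  exact List.forall_mem_append.2 ⟨maskCode_keepsArr, by simp [Instr.KeepsArr, ha]⟩

/-- Counted with multiplicity: a cell grows by the number of listed sets whose address it is. That
this number is at most one for the full list of sets is left to `update_spec`. -/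
theorem count_spec {w d n T : ℕ} {x : Fin d → ℕ} (hx : ∀ i, x i < n)
    (hT : 0 < T) (hn : n + 1 < 2 ^ w) (hN : (n + 1) ^ d ≤ 2 ^ w) (hTd : T ^ d < 2 ^ w)
    (l : List (Finset (Fin d))) {s : State} (h : TupleCtx w n T x s)
    (hc : ∀ B, s.arr 4 (address (n + 1) B x) + l.length < 2 ^ w) :
    BlockOk w (l.flatMap countStep) s ∧
    ∀ a, (runBlock (l.flatMap countStep) s).arr 4 a =
      s.arr 4 a + l.countP (fun B => address (n + 1) B x = a) := by
  induction l generalizing s with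
  | nil => simp [BlockOk]
  | cons B l ih =>
    rw [List.flatMap_cons, blockOk_append, runBlock_append]
    obtain ⟨ok, e12, e14⟩ := maskCode_spec B hx hT h hn hN hTd
    have earr : (runBlock (maskCode B) s).arr 4 = s.arr 4 := runBlock_arr maskCode_keepsArr s
    have e1 : (runBlock (maskCode B) s).reg 1 = 1 :=
      (runBlock_reg (maskCode_keepsReg (by simp) (by simp) (by simp)) s).trans h.one
    have farr : ∀ a, (runBlock (countStep B) s).arr 4 a =
        s.arr 4 a + if address (n + 1) B x = a then 1 else 0 := by
      intro a
      rw [countStep, runBlock_append]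
      simp only [runBlock_cons, Instr.apply, State.setReg, State.setArr, Op.eval, e12, earr, e1,
        runBlock_nil, Function.update_apply]
      by_cases ha : a = address (n + 1) B x
      · simp [ha]
      · simp [ha, Ne.symm ha]
    simp only [List.length_cons] at hc
    obtain ⟨ok', h'⟩ := ih (s := runBlock (countStep B) s)
      (h.congr fun j h12 h13 h14 _ => runBlock_reg (countStep_keepsReg h12 h13 h14) s) (by
        intro B'
        rw [farr]
        have := hc B'
        split_ifs <;> omega)
    refine ⟨⟨?_, ok'⟩, ?_⟩
    · rw [countStep, blockOk_append]
      refine ⟨ok, ?_⟩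
      have := hc B
      simp [BlockOk, Instr.value, Instr.apply, State.setReg, Op.eval, e12, earr, e1]
      omega
    · intro a
      rw [h', farr, List.countP_cons]
      simp only [decide_eq_true_eq]
      omega

/-- Mark the vertices of `x`. -/
def markCode (d : ℕ) : List Instr :=
  (List.finRange d).map fun i : Fin d => .store 5 (40 + i) 1

theorem markCode_spec {w d : ℕ} {x : Fin d → ℕ} (l : List (Fin d)) {s : State}
    (h1 : s.reg 1 = 1) (hX : ∀ i : Fin d, s.reg (40 + i) = x i) (hw : 1 < 2 ^ w) :
    BlockOk w (l.map fun i : Fin d => .store 5 (40 + i) 1) s ∧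
    ∀ a, (runBlock (l.map fun i : Fin d => .store 5 (40 + i) 1) s).arr 5 a =
      if ∃ i ∈ l, x i = a then 1 else s.arr 5 a := by
  induction l generalizing s with
  | nil => simp [BlockOk]
  | cons i l ih =>
    obtain ⟨ok, h⟩ := ih (s := (Instr.store 5 (40 + i) 1).apply s) h1 hX
    refine ⟨⟨by simpa [Instr.value, h1] using hw, ok⟩, fun a => ?_⟩
    rw [List.map_cons, runBlock_cons, h]
    simp only [Instr.apply, State.setArr, Function.update_self, Function.update_apply, hX, h1,
      List.exists_mem_cons_iff]
    by_cases hl : ∃ i ∈ l, x i = a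
    · simp [hl]
    · by_cases hi : x i = a
      · simp [hi]
      · simp [hl, hi, Ne.symm hi]

/-! ### Decoding an index into a tuple of common neighbors -/

/-- Split the last digit in base `R_16` off `R_12`, look up the vertex with this index, put it into
`R_(42 + i)`, and increase `R_19` if the vertex is smaller than `R_20`. -/
def decodeStep (i : ℕ) : List Instr :=
  [.arith .div 13 12 16, .arith .mul 14 13 16, .arith .sub 14 12 14, .load (42 + i) 3 14,
    .arith .add 12 13 0, .arith .sub 13 20 (42 + i), .arith .add 19 19 13,
    .arith .add 20 (42 + i) 1]

/-- Put the vertices with the indices given by the digits of `R_12` into `R_42, …`. -/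
def decode (c : ℕ) : List Instr := (List.range c).flatMap decodeStep

theorem decode_keepsReg {c j : ℕ} (h : j < 12 ∨ 14 < j ∧ j < 42) (h19 : j ≠ 19) (h20 : j ≠ 20) :
    ∀ I ∈ decode c, I.KeepsReg j := by
  simp only [decode, List.mem_flatMap, forall_exists_index, and_imp]
  intro I i _
  revert I
  simp only [decodeStep, List.forall_mem_cons, Instr.KeepsReg, List.not_mem_nil, false_imp_iff,
    implies_true, and_true]
  omega

theorem decode_keepsArr {c a : ℕ} : ∀ I ∈ decode c, I.KeepsArr a := by
  simp only [decode, List.mem_flatMap, forall_exists_index, and_imp]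
  intro I i _
  revert I
  simp [decodeStep, Instr.KeepsArr]

/-- `R_20` holds the previous vertex plus one, initially `0`. The truncated difference with the next
vertex vanishes exactly when the sequence increases there, and `R_19` sums these differences. The
clauses on `R_20` only carry this comparison through the induction. -/
theorem decode_spec {w n q r : ℕ} {s : State} (h0 : s.reg 0 = 0) (h1 : s.reg 1 = 1)
    (h12 : s.reg 12 = q) (h16 : s.reg 16 = r) (h19 : s.reg 19 = 0) (h20 : s.reg 20 = 0)
    (hr : 0 < r) (hW : ∀ t < r, s.arr 3 t < n) (hq : q < 2 ^ w) (i : ℕ)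
    (hw : i * n + n < 2 ^ w) :
    BlockOk w (decode i) s ∧ (runBlock (decode i) s).reg 12 = q / r ^ i ∧
    (∀ j < i, (runBlock (decode i) s).reg (42 + j) = s.arr 3 (q / r ^ j % r)) ∧
    (i = 0 → (runBlock (decode i) s).reg 20 = 0) ∧
    (∀ j, i = j + 1 → (runBlock (decode i) s).reg 20 = s.arr 3 (q / r ^ j % r) + 1) ∧
    (runBlock (decode i) s).reg 19 ≤ i * n ∧
    ((runBlock (decode i) s).reg 19 = 0 ↔
      ∀ j, j + 1 < i → s.arr 3 (q / r ^ j % r) < s.arr 3 (q / r ^ (j + 1) % r)) := by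
  induction i with
  | zero => simp [decode, BlockOk, h12, h19, h20]
  | succ i ih =>
    have hdec : decode (i + 1) = decode i ++ decodeStep i := by
      simp [decode, List.range_succ]
    have hmul : (i + 1) * n = i * n + n := Nat.succ_mul _ _
    obtain ⟨ok, e12, eX, e20, e20', e19, e19'⟩ := ih (by omega)
    rw [hdec, blockOk_append, runBlock_append]
    set s' := runBlock (decode i) s
    have e0 : s'.reg 0 = 0 :=
      (runBlock_reg (decode_keepsReg (by simp) (by simp) (by simp)) s).trans h0
    have e1 : s'.reg 1 = 1 :=
      (runBlock_reg (decode_keepsReg (by simp) (by simp) (by simp)) s).trans h1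
    have e16 : s'.reg 16 = r :=
      (runBlock_reg (decode_keepsReg (by simp) (by simp) (by simp)) s).trans h16
    have earr : s'.arr 3 = s.arr 3 := runBlock_arr decode_keepsArr s
    -- The machine has no remainder operation, so the last digit is obtained from the quotient.
    have hdig : q / r ^ i - q / r ^ i / r * r = q / r ^ i % r := by
      have := Nat.div_add_mod (q / r ^ i) r
      rw [mul_comm] at this
      omega
    have hdig' : ∀ j, q / r ^ j % r < r := fun j => Nat.mod_lt _ hr
    have b1 : q / r ^ i ≤ q := Nat.div_le_self _ _
    have b2 : q / r ^ i / r * r ≤ q / r ^ i := Nat.div_mul_le_self _ _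
    have b3 : q / r ^ i / r ≤ q / r ^ i := Nat.div_le_self _ _
    have b4 := hW _ (hdig' i)
    have b5 : s'.reg 20 ≤ n := by
      rcases i with _ | i
      · simp [e20 rfl]
      · rw [e20' i rfl]
        exact hW _ (hdig' i)
    have ne : ∀ j, j < 42 → 42 + i ≠ j := by omega
    have ne' : ∀ j, j < 42 → j ≠ 42 + i := by omega
    have x42 : (runBlock (decodeStep i) s').reg (42 + i) = s.arr 3 (q / r ^ i % r) := by
      simp [decodeStep, Instr.apply, State.setReg, Op.eval, e12, e16, earr, hdig, ne]
    have x12 : (runBlock (decodeStep i) s').reg 12 = q / r ^ i / r := by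
      simp [decodeStep, Instr.apply, State.setReg, Op.eval, e12, e16, e0, ne']
    have x20 : (runBlock (decodeStep i) s').reg 20 = s.arr 3 (q / r ^ i % r) + 1 := by
      simp [decodeStep, Instr.apply, State.setReg, Op.eval, e12, e16, e1, earr, hdig, ne, ne']
    have x19 : (runBlock (decodeStep i) s').reg 19 =
        s'.reg 19 + (s'.reg 20 - s.arr 3 (q / r ^ i % r)) := by
      simp [decodeStep, Instr.apply, State.setReg, Op.eval, e12, e16, earr, hdig, ne, ne']
    have xold : ∀ j < i, (runBlock (decodeStep i) s').reg (42 + j) = s'.reg (42 + j) := by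
      intro j hj
      refine runBlock_reg ?_ _
      simp only [decodeStep, List.forall_mem_cons, Instr.KeepsReg, List.not_mem_nil,
        false_imp_iff, implies_true, and_true]
      omega
    refine ⟨⟨ok, ?_⟩, ?_, ?_, ?_, ?_, ?_, ?_⟩
    · simp [decodeStep, BlockOk, Instr.value, Instr.apply, State.setReg, Op.eval, e12, e16, e0, e1,
        earr, hdig, ne, ne']
      refine ⟨?_, ?_, ?_, ?_, ?_, ?_⟩
      all_goals omega
    · rw [x12, pow_succ, Nat.div_div_eq_div_mul]
    · intro j hj
      rcases Nat.lt_succ_iff_lt_or_eq.1 hj with hj | rfl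
      · rw [xold j hj, eX j hj]
      · exact x42
    · simp
    · intro j hj
      obtain rfl : i = j := by omega
      exact x20
    · rw [x19]
      omega
    · rw [x19, Nat.add_eq_zero_iff, e19']
      constructor
      · rintro ⟨ha, hb⟩ j hj
        rcases Nat.lt_succ_iff_lt_or_eq.1 hj with hj | rfl
        · exact ha j hj
        · rw [e20' j rfl] at hb
          omega
      · intro h
        refine ⟨fun j hj => h j (by omega), ?_⟩
        rcases i with _ | i
        · simp [e20 rfl]
        · rw [e20' i rfl]
          have := h i (by omega)
          omega

/-! ### The greedy step: storing one tuple -/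

/-- The state stores the family `K` of tuples: array `A_4` holds the counters of all partial
tuples, and array `A_5` marks the vertices of all tuples. -/
structure Stored {d n : ℕ} (T : ℕ) (s : State) (K : Finset (Fin d → Fin n)) : Prop where
  sparse : Sparse T K
  counter : ∀ B x, s.arr 4 (address (n + 1) B fun i => (x i : ℕ)) = agreeCount K B x
  mark : ∀ v : Fin n, s.arr 5 v = if ∃ x ∈ K, ∃ i, x i = v then 1 else 0

theorem Stored.congr {d n T : ℕ} {s s' : State} {K : Finset (Fin d → Fin n)} (h : Stored T s K)
    (h4 : s'.arr 4 = s.arr 4) (h5 : s'.arr 5 = s.arr 5) : Stored T s' K where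
  sparse := h.sparse
  counter B x := h4 ▸ h.counter B x
  mark v := h5 ▸ h.mark v

/-- All sets of positions. -/
noncomputable def masks (d : ℕ) : List (Finset (Fin d)) := Finset.univ.toList

/-- Add the tuple in `R_40, …` to the stored family. -/
noncomputable def updateBlock (d : ℕ) : List Instr := (masks d).flatMap countStep ++ markCode d

theorem updateBlock_keepsReg {d j : ℕ} (h12 : j ≠ 12) (h13 : j ≠ 13) (h14 : j ≠ 14) :
    ∀ I ∈ updateBlock d, I.KeepsReg j := by
  refine List.forall_mem_append.2 ⟨fun I hI => ?_, by simp [markCode, Instr.KeepsReg]⟩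
  obtain ⟨B, -, hB⟩ := List.mem_flatMap.1 hI
  exact countStep_keepsReg h12 h13 h14 I hB

theorem updateBlock_keepsArr {d a : ℕ} (h4 : a ≠ 4) (h5 : a ≠ 5) :
    ∀ I ∈ updateBlock d, I.KeepsArr a := by
  refine List.forall_mem_append.2 ⟨fun I hI => ?_, by simp [markCode, Instr.KeepsArr, h5]⟩
  obtain ⟨B, -, hB⟩ := List.mem_flatMap.1 hI
  exact countStep_keepsArr h4 I hB

/-- For given `B` and `y`, exactly one set can have the address of `(B, y)` when combined with `x`,
namely `B` itself, and only if `x` and `y` agree on `B`. The counter thus follows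
`agreeCount_insert`. -/
theorem update_spec {w d n T : ℕ} {x : Fin d → Fin n}
    (hT : 0 < T) (hn : n + 1 < 2 ^ w) (hN : (n + 1) ^ d ≤ 2 ^ w)
    (hTd : T ^ d + (masks d).length < 2 ^ w) {s : State}
    (h : TupleCtx w n T (fun i => (x i : ℕ)) s) {K : Finset (Fin d → Fin n)} (hK : Stored T s K)
    (hx : ¬ Saturated T K x) :
    BlockOk w (updateBlock d) s ∧ Stored T (runBlock (updateBlock d) s) (insert x K) := by
  have hxK : x ∉ K := fun h => hx (saturated_of_mem h)
  obtain ⟨ok, h4⟩ := count_spec (fun i => (x i).isLt) hT hn hN (by omega) (masks d) h (by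
    intro B
    rw [hK.counter]
    have h1 := hK.sparse B x
    have h2 : T ^ (Fintype.card (Fin d) - B.card) ≤ T ^ d :=
      Nat.pow_le_pow_right hT (by simp)
    omega)
  have k1 : ∀ j, j ≠ 12 → j ≠ 13 → j ≠ 14 →
      (runBlock ((masks d).flatMap countStep) s).reg j = s.reg j := fun j h12 h13 h14 =>
    runBlock_reg (fun I hI => by
      obtain ⟨B, -, hB⟩ := List.mem_flatMap.1 hI
      exact countStep_keepsReg h12 h13 h14 I hB) s
  have k2 : (runBlock ((masks d).flatMap countStep) s).arr 5 = s.arr 5 :=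
    runBlock_arr (fun I hI => by
      obtain ⟨B, -, hB⟩ := List.mem_flatMap.1 hI
      exact countStep_keepsArr (by simp) I hB) s
  have hctx := h.congr fun j h12 h13 h14 _ => k1 j h12 h13 h14
  obtain ⟨ok', h5⟩ := markCode_spec (List.finRange d) hctx.one hctx.tuple (w := w) (by omega)
  refine ⟨(blockOk_append _ _ _).2 ⟨ok, ok'⟩, hK.sparse.insert_of_not_saturated hx, ?_, ?_⟩
  · intro B y
    rw [updateBlock, runBlock_append, runBlock_arr (by simp [markCode, Instr.KeepsArr]), h4,
      hK.counter, agreeCount_insert hxK]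
    congr 1
    have hcount : ∀ B', decide (address (n + 1) B' (fun i => (x i : ℕ)) =
        address (n + 1) B fun i => (y i : ℕ)) = (decide (∀ i ∈ B, x i = y i) && B' == B) := by
      intro B'
      rw [Bool.eq_iff_iff]
      simp only [address_eq_iff, decide_eq_true_eq, Bool.and_eq_true, beq_iff_eq]
      constructor
      · rintro ⟨rfl, h⟩
        exact ⟨h, rfl⟩
      · rintro ⟨h, rfl⟩
        exact ⟨rfl, h⟩
    simp only [hcount]
    by_cases hxy : ∀ i ∈ B, x i = y i
    · rw [if_pos hxy, decide_eq_true hxy]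
      simp only [Bool.true_and]
      rw [← List.count]
      -- Every set of positions is listed once in `masks`, so the increment is exactly one.
      exact List.count_eq_one_of_mem (Finset.nodup_toList _) (by simp [masks])
    · rw [if_neg hxy, decide_eq_false hxy]
      simp
  · intro v
    rw [updateBlock, runBlock_append, markCode, h5, k2, hK.mark]
    simp only [List.mem_finRange, true_and, Finset.exists_mem_insert, Fin.val_inj]
    by_cases h1 : ∃ i, x i = v
    · simp [h1]
    · simp only [h1, if_false, false_or]

/-- Decode the tuple with index `R_18`; afterwards `R_19 = 0` if it has to be stored. -/
noncomputable def tupleBlock (c : ℕ) : List Instr :=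
  ([.arith .add 12 18 0, .const 19 0, .const 20 0] ++ decode c) ++
    (masks (c + 2)).flatMap checkStep

/-- Handle the tuple with index `R_18`. -/
noncomputable def tupleProg (c : ℕ) : Prog :=
  .seq (.block (tupleBlock c)) (.ite (.eq 19 0) (.block (updateBlock (c + 2))) .skip)

theorem tupleBlock_keepsReg {c j : ℕ} (h : j < 12 ∨ 14 < j ∧ j < 42) (h19 : j ≠ 19)
    (h20 : j ≠ 20) : ∀ I ∈ tupleBlock c, I.KeepsReg j := by
  refine List.forall_mem_append.2 ⟨List.forall_mem_append.2 ⟨?_, decode_keepsReg h h19 h20⟩, ?_⟩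
  · simp only [List.forall_mem_cons, Instr.KeepsReg, List.not_mem_nil, false_imp_iff,
      implies_true, and_true]
    omega
  · intro I hI
    obtain ⟨B, -, hB⟩ := List.mem_flatMap.1 hI
    exact checkStep_keepsReg (by omega) (by omega) (by omega) h19 I hB

theorem tupleBlock_keepsArr {c a : ℕ} : ∀ I ∈ tupleBlock c, I.KeepsArr a := by
  refine List.forall_mem_append.2 ⟨List.forall_mem_append.2 ⟨?_, decode_keepsArr⟩, ?_⟩
  · simp [Instr.KeepsArr]
  · intro I hI
    obtain ⟨B, -, hB⟩ := List.mem_flatMap.1 hI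
    exact checkStep_keepsArr I hB

theorem tupleProg_keepsReg {c j : ℕ} (h : j < 12 ∨ 14 < j ∧ j < 42) (h19 : j ≠ 19)
    (h20 : j ≠ 20) : (tupleProg c).KeepsReg j :=
  ⟨keepsReg_block.2 (tupleBlock_keepsReg h h19 h20),
    keepsReg_block.2 (updateBlock_keepsReg (by omega) (by omega) (by omega)), trivial⟩

theorem tupleProg_keepsArr {c a : ℕ} (h4 : a ≠ 4) (h5 : a ≠ 5) : (tupleProg c).KeepsArr a :=
  ⟨keepsArr_block.2 tupleBlock_keepsArr, keepsArr_block.2 (updateBlock_keepsArr h4 h5), trivial⟩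

/-- An upper bound for the number of steps of `tupleProg`. -/
noncomputable def tupleTime (c : ℕ) : ℕ :=
  (tupleBlock c).length + (updateBlock (c + 2)).length + 3

/-- The common neighbors in the tuple are listed in increasing order. -/
def Increasing {c n : ℕ} (x : Fin (c + 2) → Fin n) : Prop :=
  ∀ i j : Fin c, i < j → x i.succ.succ < x j.succ.succ

/-- Comparing neighboring entries suffices, by transitivity; these are the only comparisons the
program makes. -/
theorem increasing_iff {c n : ℕ} {x : Fin (c + 2) → Fin n} {X : ℕ → ℕ}
    (hX : ∀ i : Fin c, X i = x i.succ.succ) :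
    Increasing x ↔ ∀ j, j + 1 < c → X j < X (j + 1) := by
  constructor
  · intro h j hj
    have := h ⟨j, by omega⟩ ⟨j + 1, hj⟩ (by simp [Fin.lt_def])
    rwa [Fin.lt_def, ← hX, ← hX] at this
  · intro h i j hij
    rw [Fin.lt_def, ← hX, ← hX]
    have key : ∀ m, (i : ℕ) + 1 ≤ m → m < c → X i < X m := by
      intro m hm
      induction m, hm using Nat.le_induction with
      | base => exact h i
      | succ m hm ih => exact fun hc => (ih (by omega)).trans (h m hc)
    exact key j hij j.isLt

theorem not_saturated_iff {d n T : ℕ} {s : State} {K : Finset (Fin d → Fin n)} (hK : Stored T s K)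
    {x : Fin d → Fin n} : ¬ Saturated T K x ↔
      ∀ B ∈ masks d, s.arr 4 (address (n + 1) B fun i => (x i : ℕ)) < T ^ (d - B.card) := by
  simp [Saturated, masks, hK.counter]

/-- `R_19` collects the failures of monotonicity and the reached thresholds, so a single test for
`0` decides both. An increasing tuple ends up saturated in either case: it is rejected because it
already is, or it becomes so by being stored. -/
theorem tupleProg_spec {w c n T q r : ℕ} {s : State} {x : Fin (c + 2) → Fin n}
    {K : Finset (Fin (c + 2) → Fin n)} (h0 : s.reg 0 = 0) (h1 : s.reg 1 = 1)
    (h5 : s.reg 5 = n + 1) (h6 : s.reg 6 = T) (h16 : s.reg 16 = r) (h18 : s.reg 18 = q)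
    (h40 : s.reg 40 = x 0) (h41 : s.reg 41 = x 1) (hr : 0 < r) (hW : ∀ t < r, s.arr 3 t < n)
    (hx : ∀ i : Fin c, s.arr 3 (q / r ^ (i : ℕ) % r) = x i.succ.succ) (hT : 0 < T)
    (hn : n + 1 < 2 ^ w) (hN : (n + 1) ^ (c + 2) ≤ 2 ^ w)
    (hTd : T ^ (c + 2) + (masks (c + 2)).length < 2 ^ w)
    (hcn : c * n + n + (masks (c + 2)).length < 2 ^ w) (hq : q < 2 ^ w) (hK : Stored T s K) :
    WP w (tupleProg c) s (tupleTime c) fun s' => ∃ K', K ⊆ K' ∧ Stored T s' K' ∧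
      (∀ y ∈ K', y ∈ K ∨ y = x ∧ Increasing x) ∧ (Increasing x → Saturated T K' x) := by
  set s₁ := runBlock [.arith .add 12 18 0, .const 19 0, .const 20 0] s with hs₁
  have hr1 : ∀ j, j ≠ 12 → j ≠ 19 → j ≠ 20 → s₁.reg j = s.reg j := fun j h12 h19 h20 =>
    runBlock_reg (by simp [Instr.KeepsReg, *]) s
  have ha1 : ∀ a, s₁.arr a = s.arr a := fun a => runBlock_arr (by simp [Instr.KeepsArr]) s
  have e12 : s₁.reg 12 = q := by simp [hs₁, Instr.apply, State.setReg, Op.eval, h18, h0]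
  have e19 : s₁.reg 19 = 0 := by simp [hs₁, Instr.apply, State.setReg]
  have e20 : s₁.reg 20 = 0 := by simp [hs₁, Instr.apply, State.setReg]
  have ok1 : BlockOk w [.arith .add 12 18 0, .const 19 0, .const 20 0] s := by
    simp [BlockOk, Instr.value, Op.eval, h18, h0, hq]
  obtain ⟨ok2, -, hX, -, -, b19, f19⟩ := decode_spec (w := w) (n := n) (s := s₁)
    (by rw [hr1] <;> simp [h0]) (by rw [hr1] <;> simp [h1]) e12 (by rw [hr1] <;> simp [h16])
    e19 e20 hr (by simpa only [ha1] using hW) hq c (by omega)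
  simp only [ha1] at hX f19
  rw [← increasing_iff (x := x) (X := fun j => s.arr 3 (q / r ^ j % r)) hx] at f19
  set s₂ := runBlock (decode c) s₁ with hs₂
  have hr2 : ∀ j, j < 12 ∨ 14 < j ∧ j < 42 → j ≠ 19 → j ≠ 20 → s₂.reg j = s.reg j :=
    fun j h h19 h20 => (runBlock_reg (decode_keepsReg h h19 h20) s₁).trans
      (hr1 j (by omega) h19 h20)
  have ha2 : ∀ a, s₂.arr a = s.arr a := fun a => (runBlock_arr decode_keepsArr s₁).trans (ha1 a)
  have ctx : TupleCtx w n T (fun i => (x i : ℕ)) s₂ :=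
    { one := by rw [hr2] <;> simp [h1]
      base := by rw [hr2] <;> simp [h5]
      thr := by rw [hr2] <;> simp [h6]
      tuple := by
        intro i
        induction i using Fin.cases with
        | zero => exact (hr2 40 (by simp) (by simp) (by simp)).trans h40
        | succ i =>
          induction i using Fin.cases with
          | zero => exact (hr2 41 (by simp) (by simp) (by simp)).trans h41
          | succ i =>
            rw [← hx i, ← hX i i.isLt]
            congr 1
            simp only [Fin.val_succ]
            omega }
  have hK2 : Stored T s₂ K := hK.congr (ha2 4) (ha2 5)
  obtain ⟨ok3, g19⟩ := check_spec (fun i => (x i).isLt) hT hn hN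
    (by have : 0 < (masks (c + 2)).length := List.length_pos_of_mem (a := ∅) (by simp [masks])
        omega) (masks (c + 2)) ctx
    (fun B => by rw [hK2.counter]; simpa using hK2.sparse B x) (by omega)
  rw [← not_saturated_iff hK2, f19] at g19
  set s₃ := runBlock ((masks (c + 2)).flatMap checkStep) s₂ with hs₃
  have hr3 : ∀ j, j ≠ 12 → j ≠ 13 → j ≠ 14 → j ≠ 19 → s₃.reg j = s₂.reg j :=
    fun j h12 h13 h14 h19 => runBlock_reg (fun I hI => by
      obtain ⟨B, -, hB⟩ := List.mem_flatMap.1 hI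
      exact checkStep_keepsReg h12 h13 h14 h19 I hB) s₂
  have ha3 : ∀ a, s₃.arr a = s₂.arr a := fun a => runBlock_arr (fun I hI => by
      obtain ⟨B, -, hB⟩ := List.mem_flatMap.1 hI
      exact checkStep_keepsArr I hB) s₂
  have hK3 : Stored T s₃ K := hK2.congr (ha3 4) (ha3 5)
  have z3 : s₃.reg 0 = 0 := by rw [hr3, hr2] <;> simp [h0]
  have hrun : runBlock (tupleBlock c) s = s₃ := by
    rw [tupleBlock, runBlock_append, runBlock_append]
  have hok : BlockOk w (tupleBlock c) s := by
    rw [tupleBlock, blockOk_append, blockOk_append, runBlock_append]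
    exact ⟨⟨ok1, ok2⟩, ok3⟩
  have main : WP w (.ite (.eq 19 0) (.block (updateBlock (c + 2))) .skip) s₃
      ((updateBlock (c + 2)).length + 1 + 1) fun s' => ∃ K', K ⊆ K' ∧ Stored T s' K' ∧
      (∀ y ∈ K', y ∈ K ∨ y = x ∧ Increasing x) ∧ (Increasing x → Saturated T K' x) := by
    refine WP.ite (fun hb => ?_) fun hb => ?_
    · simp only [Test.Holds, z3] at hb
      obtain ⟨hinc, hsat⟩ := g19.1 hb
      obtain ⟨ok4, hK4⟩ := update_spec hT hn hN hTd
        (ctx.congr fun j h12 h13 h14 h19 => hr3 j h12 h13 h14 h19) hK3 hsat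
      refine WP.block ok4 ⟨_, Finset.subset_insert _ _, hK4, fun y hy => ?_, fun _ =>
        saturated_of_mem (Finset.mem_insert_self _ _)⟩
      rcases Finset.mem_insert.1 hy with rfl | hy
      · exact Or.inr ⟨rfl, hinc⟩
      · exact Or.inl hy
    · simp only [Test.Holds, z3] at hb
      rw [g19] at hb
      refine (WP.skip ⟨K, subset_rfl, hK3, fun y hy => Or.inl hy, fun hi => ?_⟩).mono (by omega)
        fun _ h => h
      by_contra hsat
      exact hb ⟨hi, hsat⟩
  refine (WP.seq (WP.block hok (hrun ▸ main))).mono ?_ fun _ h => h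
  unfold tupleTime
  omega

/-! ### Powers, word length, and the list of common neighbors -/

/-- `R_a := R_b ^ c`. -/
def powBlock (a b c : ℕ) : List Instr := .const a 1 :: List.replicate c (.arith .mul a a b)

theorem powBlock_keepsReg {a b c j : ℕ} (h : j ≠ a) : ∀ I ∈ powBlock a b c, I.KeepsReg j := by
  refine List.forall_mem_cons.2 ⟨h, fun I hI => ?_⟩
  rw [List.eq_of_mem_replicate hI]
  exact h

theorem powBlock_keepsArr {a b c j : ℕ} : ∀ I ∈ powBlock a b c, I.KeepsArr j := by
  refine List.forall_mem_cons.2 ⟨trivial, fun I hI => ?_⟩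
  rw [List.eq_of_mem_replicate hI]
  trivial

theorem powBlock_spec {w a b c r : ℕ} (hab : b ≠ a) {s : State} (hb : s.reg b = r)
    (hw : r ^ c < 2 ^ w) (hw1 : 1 < 2 ^ w) :
    BlockOk w (powBlock a b c) s ∧ (runBlock (powBlock a b c) s).reg a = r ^ c := by
  have hle : ∀ i ≤ c, r ^ i < 2 ^ w := by
    intro i hi
    rcases r.eq_zero_or_pos with rfl | hr
    · have : 0 ^ i ≤ 1 := by
        rcases i with _ | i <;> simp
      omega
    · have := Nat.pow_le_pow_right hr hi
      omega
  have key : ∀ l i (s : State), i + l = c → s.reg b = r → s.reg a = r ^ i →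
      BlockOk w (List.replicate l (.arith .mul a a b)) s ∧
      (runBlock (List.replicate l (.arith .mul a a b)) s).reg a = r ^ c := by
    intro l
    induction l with
    | zero =>
      rintro i s rfl _ ha
      exact ⟨trivial, ha⟩
    | succ l ih =>
      intro i s hi hb ha
      have e : ((Instr.arith .mul a a b).apply s).reg a = r ^ (i + 1) := by
        simp [Instr.apply, State.setReg, Op.eval, ha, hb, pow_succ]
      obtain ⟨ok, h⟩ := ih (i + 1) ((Instr.arith .mul a a b).apply s) (by omega)
        (by simp [Instr.apply, State.setReg, hab, hb]) e
      refine ⟨⟨?_, ok⟩, h⟩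
      simp only [Instr.value, Op.eval, ha, hb, ← pow_succ]
      exact hle _ (by omega)
  obtain ⟨ok, h⟩ := key c 0 ((Instr.const a 1).apply s) (by simp)
    (by simp [Instr.apply, State.setReg, hab, hb]) (by simp [Instr.apply, State.setReg])
  exact ⟨⟨by simp only [Instr.value]; omega, ok⟩, h⟩

/-- The word length suffices for all numbers that occur. -/
structure Fits (w c n k m : ℕ) : Prop where
  sq : n * n + n < 2 ^ w
  succ : n + 1 < 2 ^ w
  addr : (n + 1) ^ (c + 2) ≤ 2 ^ w
  thr : ((c + 2) * k + 1) ^ (c + 2) + (masks (c + 2)).length < 2 ^ w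
  digits : c * n + n + (masks (c + 2)).length < 2 ^ w
  pow : (c + k) ^ c < 2 ^ w
  cap : c + k < 2 ^ w
  edges : 2 * m + 5 < 2 ^ w

/-- The contents of the registers that hold the constants of the computation. -/
structure Ctx (c n k m : ℕ) (s : State) : Prop where
  zero : s.reg 0 = 0
  one : s.reg 1 = 1
  verts : s.reg 2 = n
  param : s.reg 3 = k
  edges : s.reg 4 = m
  base : s.reg 5 = n + 1
  thr : s.reg 6 = (c + 2) * k + 1
  cap : s.reg 7 = c + k
  two : s.reg 9 = 2
  three : s.reg 10 = 3

theorem Ctx.congr {c n k m : ℕ} {s s' : State} (h : Ctx c n k m s)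
    (hs : ∀ j ≤ 10, s'.reg j = s.reg j) : Ctx c n k m s' := by
  constructor <;> rw [hs _ (by simp)]
  exacts [h.zero, h.one, h.verts, h.param, h.edges, h.base, h.thr, h.cap, h.two, h.three]

open scoped Classical in
/-- Array `A_2` holds the adjacency matrix. -/
def AdjStored {n : ℕ} (G : SimpleGraph (Fin n)) (s : State) : Prop :=
  ∀ u v : Fin n, s.arr 2 (u * n + v) = if G.Adj u v then 1 else 0

/-- Append the vertex `R_11` to the list of common neighbors if it is one. -/
def neighborBlock : List Instr :=
  [.store 3 16 11, .arith .mul 12 40 2, .arith .add 12 12 11, .load 12 2 12, .arith .mul 13 41 2,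
    .arith .add 13 13 11, .load 13 2 13, .arith .mul 12 12 13, .arith .add 16 16 12]

theorem neighborBlock_keepsReg {j : ℕ} (h12 : j ≠ 12) (h13 : j ≠ 13) (h16 : j ≠ 16) :
    ∀ I ∈ neighborBlock, I.KeepsReg j := by
  simp [neighborBlock, Instr.KeepsReg, *]

theorem neighborBlock_keepsArr {a : ℕ} (h3 : a ≠ 3) : ∀ I ∈ neighborBlock, I.KeepsArr a := by
  simp [neighborBlock, Instr.KeepsArr, *]

/-- `a` is a common neighbor of `u` and `v`. -/
def IsCommon {n : ℕ} (G : SimpleGraph (Fin n)) (u v : Fin n) (a : ℕ) : Prop :=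
  ∃ h : a < n, G.Adj u ⟨a, h⟩ ∧ G.Adj v ⟨a, h⟩

open scoped Classical in
-- Each vertex is written to the next free cell unconditionally, and the fill level advances by the
-- product of two adjacency entries. A vertex that is not a common neighbor is thereby overwritten
-- or left beyond the end, while a common neighbor `a` stays at the index counting its predecessors.
theorem neighborLoop_spec {w c n k m : ℕ} {G : SimpleGraph (Fin n)} {s : State}
    (hw : Fits w c n k m) (hc : Ctx c n k m s) (hG : AdjStored G s) {u v : Fin n}
    (hu : s.reg 40 = u) (hv : s.reg 41 = v) (h16 : s.reg 16 = 0) :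
    WP w (.forLoop 11 2 (.block neighborBlock)) s (n * 12 + 2) fun s' =>
      s'.reg 16 = Nat.count (IsCommon G u v) n ∧
      ∀ a < n, IsCommon G u v a → s'.arr 3 (Nat.count (IsCommon G u v) a) = a := by
  have k : ∀ {j : ℕ}, j ≠ 12 → j ≠ 13 → j ≠ 16 → (Prog.block neighborBlock).KeepsReg j :=
    fun h12 h13 h16 => keepsReg_block.2 (neighborBlock_keepsReg h12 h13 h16)
  refine (WP.forLoop (w := w) (N := n) (T := 10) (fun i s =>
      s.reg 16 = Nat.count (IsCommon G u v) i ∧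
      ∀ a < i, IsCommon G u v a → s.arr 3 (Nat.count (IsCommon G u v) a) = a)
    hc.verts hc.one (by have := hw.succ; omega) (by simp) (by simp) (k (by simp) (by simp) (by simp))
    (k (by simp) (by simp) (by simp)) (k (by simp) (by simp) (by simp)) ?_ ?_ ?_)
  · simp [State.setReg, h16]
  · intro i s' hi h11 hr ha ⟨h16', hI⟩
    have e2 : s'.reg 2 = n :=
      (hr 2 (by simp) (k (by simp) (by simp) (by simp))).trans hc.verts
    have e40 : s'.reg 40 = u := (hr 40 (by simp) (k (by simp) (by simp) (by simp))).trans hu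
    have e41 : s'.reg 41 = v := (hr 41 (by simp) (k (by simp) (by simp) (by simp))).trans hv
    have a2 : s'.arr 2 = s.arr 2 :=
      ha 2 (keepsArr_block.2 (neighborBlock_keepsArr (by simp)))
    have g1 : s'.arr 2 (u * n + i) = if G.Adj u ⟨i, hi⟩ then 1 else 0 := a2 ▸ hG u ⟨i, hi⟩
    have g2 : s'.arr 2 (v * n + i) = if G.Adj v ⟨i, hi⟩ then 1 else 0 := a2 ▸ hG v ⟨i, hi⟩
    have hcount : Nat.count (IsCommon G u v) i +
        s'.arr 2 (u * n + i) * s'.arr 2 (v * n + i) = Nat.count (IsCommon G u v) (i + 1) := by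
      rw [Nat.count_succ, g1, g2]
      congr 1
      by_cases h1 : G.Adj u ⟨i, hi⟩ <;> by_cases h2 : G.Adj v ⟨i, hi⟩ <;>
        simp [IsCommon, hi, h1, h2]
    have hle : Nat.count (IsCommon G u v) (i + 1) ≤ i + 1 := Nat.count_le _
    have b1 : (u : ℕ) * n ≤ n * n := Nat.mul_le_mul_right _ u.isLt.le
    have b2 : (v : ℕ) * n ≤ n * n := Nat.mul_le_mul_right _ v.isLt.le
    have b3 : s'.arr 2 (u * n + i) ≤ 1 := by rw [g1]; split_ifs <;> simp
    have b4 : s'.arr 2 (v * n + i) ≤ 1 := by rw [g2]; split_ifs <;> simp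
    have b5 := hw.sq
    have b6 := hw.succ
    refine WP.block ?_ ⟨?_, fun a hai hcom => ?_⟩
    · simp only [neighborBlock, BlockOk, Instr.value, Instr.apply, State.setReg, State.setArr,
        Op.eval, Function.update_apply, e2, e40, e41, h11, h16']
      simp [hcount]
      omega
    · simp only [neighborBlock, runBlock_cons, runBlock_nil, Instr.apply, State.setReg,
        State.setArr, Op.eval, Function.update_apply, e2, e40, e41, h11, h16']
      simp [hcount]
    · simp only [neighborBlock, runBlock_cons, runBlock_nil, Instr.apply, State.setReg,
        State.setArr, Op.eval, Function.update_apply, h11, h16']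
      simp only [if_true, Function.update_apply]
      rcases Nat.lt_succ_iff_lt_or_eq.1 hai with hai | rfl
      · rw [if_neg, hI a hai hcom]
        -- An earlier common neighbor lies strictly below the fill level, so the new write does not
        -- touch it.
        intro heq
        have h1 : Nat.count (IsCommon G u v) (a + 1) ≤ Nat.count (IsCommon G u v) i :=
          Nat.count_monotone _ hai
        rw [Nat.count_succ, if_pos hcom] at h1
        omega
      · simp
  · intro s' _ _ h
    exact h

/-- The vertex with index `t` in the list `A`. -/
def listVertex {n : ℕ} (u : Fin n) (A : ℕ → ℕ) (t : ℕ) : Fin n :=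
  if h : A t < n then ⟨A t, h⟩ else u

/-- The `q`-th tuple formed by `u`, `v` and `c` of the first `r` vertices in the list `A`. -/
def tupleOf {n : ℕ} (c : ℕ) (u v : Fin n) (A : ℕ → ℕ) (r q : ℕ) : Fin (c + 2) → Fin n :=
  Fin.cons u (Fin.cons v fun i : Fin c => listVertex u A (q / r ^ (i : ℕ) % r))

open scoped Classical in
-- `Nat.nth` inverts `Nat.count`: the cell `t` must contain the common neighbor with exactly `t`
-- predecessors. In particular, the list has no repetitions.
theorem listVertex_spec {n : ℕ} {G : SimpleGraph (Fin n)} {u v : Fin n} {A : ℕ → ℕ}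
    (hA : ∀ a < n, IsCommon G u v a → A (Nat.count (IsCommon G u v) a) = a) {t : ℕ}
    (ht : t < Nat.count (IsCommon G u v) n) :
    A t < n ∧ listVertex u A t ∈ G.commonNeighbors u v ∧
      Nat.count (IsCommon G u v) (listVertex u A t) = t := by
  have hfin : ∀ hf : (Set.ofPred (IsCommon G u v)).Finite, t < hf.toFinset.card := by
    intro hf
    refine ht.trans_le ?_
    rw [Nat.count_eq_card_filter_range]
    exact Finset.card_le_card fun a ha => by simpa using (Finset.mem_filter.1 ha).2
  have h1 : IsCommon G u v (Nat.nth (IsCommon G u v) t) := Nat.nth_mem t hfin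
  have h2 : Nat.count (IsCommon G u v) (Nat.nth (IsCommon G u v) t) = t := Nat.count_nth hfin
  have h3 := hA _ h1.choose h1
  rw [h2] at h3
  have h4 : A t < n := h3 ▸ h1.choose
  have h5 : ((listVertex u A t : Fin n) : ℕ) = Nat.nth (IsCommon G u v) t := by
    simp [listVertex, h3, h1.choose]
  refine ⟨h4, ?_, by rw [h5, h2]⟩
  rw [SimpleGraph.mem_commonNeighbors]
  obtain ⟨h, h6⟩ := h1
  have : listVertex u A t = ⟨_, h⟩ := Fin.ext h5
  rwa [this]

theorem forbidden_tupleOf {n c r q : ℕ} {G : SimpleGraph (Fin n)} {u v : Fin n} {A : ℕ → ℕ}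
    (huv : v < u) (hadj : ¬ G.Adj u v) (hr : 0 < r)
    (hA : ∀ t < r, listVertex u A t ∈ G.commonNeighbors u v)
    (h : Increasing (tupleOf c u v A r q)) : Forbidden G (tupleOf c u v A r q) where
  ne := huv.ne'
  not_adj := hadj
  inj := StrictMono.injective fun _ _ hij => h _ _ hij
  mem _ := hA _ (Nat.mod_lt _ hr)

open scoped Classical in
-- The first `r` listed vertices serve as `W`: they are all common neighbors, or `c + k` of them. As
-- `q` runs below `r ^ c`, its base-`r` digits run through all functions from `Fin c` to `Fin r`, so
-- each increasing selection from `W` is met.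
theorem pairDone_of_tupleOf {n c k r : ℕ} {G : SimpleGraph (Fin n)} {u v : Fin n} {A : ℕ → ℕ}
    {K : Finset (Fin (c + 2) → Fin n)}
    (hA : ∀ a < n, IsCommon G u v a → A (Nat.count (IsCommon G u v) a) = a)
    (hr : r = min (Nat.count (IsCommon G u v) n) (c + k))
    (hK : ∀ q < r ^ c, Increasing (tupleOf c u v A r q) →
      Saturated ((c + 2) * k + 1) K (tupleOf c u v A r q)) : PairDone c k G K u v := by
  have hspec : ∀ t < r, _ := fun t ht => listVertex_spec hA (t := t) (by omega)
  refine ⟨(Finset.range r).image (listVertex u A), ?_, fun g hg hgW => ?_⟩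
  · rcases le_total (c + k) (Nat.count (IsCommon G u v) n) with h | h
    · right
      rw [min_eq_right h] at hr
      rw [Finset.card_image_of_injOn, Finset.card_range, hr]
      · refine ⟨le_rfl, ?_⟩
        intro a ha
        simp only [Finset.coe_image, Set.mem_image, Finset.coe_range, Set.mem_Iio] at ha
        obtain ⟨t, ht, rfl⟩ := ha
        exact (hspec t (by omega)).2.1
      · intro t ht t' ht' h
        simp only [Finset.coe_range, Set.mem_Iio] at ht ht'
        rw [← (hspec t ht).2.2, ← (hspec t' ht').2.2, h]
    · left
      rw [min_eq_left h] at hr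
      intro a ha
      have hcom : IsCommon G u v a := ⟨a.isLt, ha⟩
      have hlt : Nat.count (IsCommon G u v) a < r := hr ▸ Nat.count_strict_mono hcom a.isLt
      simp only [Finset.coe_image, Set.mem_image, Finset.coe_range, Set.mem_Iio]
      refine ⟨_, hlt, Fin.ext ?_⟩
      simp [listVertex, hA a a.isLt hcom]
  · simp only [Finset.mem_image, Finset.mem_range] at hgW
    choose t ht hgt using hgW
    -- `finFunctionFinEquiv` encodes a function by the same base-`r` digits that the program
    -- extracts.
    have hdig : ∀ i : Fin c, (finFunctionFinEquiv fun i => (⟨t i, ht i⟩ : Fin r) : ℕ) /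
        r ^ (i : ℕ) % r = t i := by
      intro i
      have := congrFun (finFunctionFinEquiv.symm_apply_apply fun i => (⟨t i, ht i⟩ : Fin r)) i
      simpa [finFunctionFinEquiv] using congrArg Fin.val this
    have hx : tupleOf c u v A r (finFunctionFinEquiv fun i => (⟨t i, ht i⟩ : Fin r)) =
        Fin.cons u (Fin.cons v g) := by
      unfold tupleOf
      congr 2
      funext i
      rw [hdig, hgt]
    rw [← hx]
    refine hK _ (Fin.isLt _) ?_
    rw [hx]
    exact fun i j hij => hg i j hij

/-! ### Processing one pair of vertices -/

/-- Handle the nonadjacent pair of vertices `R_40` and `R_41`. -/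
noncomputable def pairBody (c : ℕ) : Prog :=
  .seq (.block [.const 16 0]) <| .seq (.forLoop 11 2 (.block neighborBlock)) <|
    .seq (.ite (.lt 7 16) (.block [.arith .add 16 7 0]) .skip) <|
    .seq (.block (powBlock 17 16 c)) (.forLoop 18 17 (tupleProg c))

/-- Handle the pair of vertices `R_40` and `R_41`. -/
noncomputable def pairProg (c : ℕ) : Prog :=
  .seq (.block [.arith .mul 15 40 2, .arith .add 15 15 41, .load 15 2 15])
    (.ite (.eq 15 0) (pairBody c) .skip)

theorem pairProg_keepsReg {c j : ℕ} (h : j < 11 ∨ 20 < j ∧ j < 42) :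
    (pairProg c).KeepsReg j := by
  refine ⟨keepsReg_block.2 ?_, ⟨keepsReg_block.2 ?_, keepsReg_forLoop.2 ⟨by omega,
    keepsReg_block.2 (neighborBlock_keepsReg (by omega) (by omega) (by omega))⟩,
    ⟨keepsReg_block.2 ?_, trivial⟩, keepsReg_block.2 (powBlock_keepsReg (by omega)),
    keepsReg_forLoop.2 ⟨by omega, tupleProg_keepsReg (by omega) (by omega) (by omega)⟩⟩,
    trivial⟩
  all_goals
    simp [Instr.KeepsReg]
    try omega

theorem pairProg_keepsArr {c a : ℕ} (h3 : a ≠ 3) (h4 : a ≠ 4) (h5 : a ≠ 5) :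
    (pairProg c).KeepsArr a := by
  refine ⟨keepsArr_block.2 ?_, ⟨keepsArr_block.2 ?_, keepsArr_forLoop.2
    (keepsArr_block.2 (neighborBlock_keepsArr h3)), ⟨keepsArr_block.2 ?_, trivial⟩,
    keepsArr_block.2 powBlock_keepsArr, keepsArr_forLoop.2 (tupleProg_keepsArr h4 h5)⟩, trivial⟩
  all_goals simp [Instr.KeepsArr]

/-- An upper bound for the number of steps of `pairProg`, where `L` bounds the number of
tuples. -/
noncomputable def pairTime (c n L : ℕ) : ℕ := n * 12 + L * (tupleTime c + 2) + c + 20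

open scoped Classical in
-- The loop invariant says that all increasing tuples with index below the counter are saturated. It
-- survives later insertions because saturation is monotone in the family.
theorem pairBody_spec {w c n k m : ℕ} {G : SimpleGraph (Fin n)} {s : State}
    (hw : Fits w c n k m) (hc : Ctx c n k m s) (hG : AdjStored G s) {u v : Fin n}
    (hu : s.reg 40 = u) (hv : s.reg 41 = v) (huv : v < u) (hadj : ¬ G.Adj u v) (hc0 : c ≠ 0)
    {K : Finset (Fin (c + 2) → Fin n)} (hK : Stored ((c + 2) * k + 1) s K) :
    WP w (pairBody c) s (n * 12 + (c + k) ^ c * (tupleTime c + 2) + c + 14) fun s' =>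
      ∃ K', K ⊆ K' ∧ Stored ((c + 2) * k + 1) s' K' ∧
      (∀ y ∈ K', y ∈ K ∨ Forbidden G y) ∧ PairDone c k G K' u v := by
  have bn := hw.succ
  have bcap := hw.cap
  set s₁ := s.setReg 16 0 with hs₁
  have hc1 : Ctx c n k m s₁ := hc.congr fun j hj => by
    simp [hs₁, State.setReg, show j ≠ 16 by omega]
  have hnb := (neighborLoop_spec (u := u) (v := v) hw hc1 (s := s₁) hG
    (by simp [hs₁, State.setReg, hu]) (by simp [hs₁, State.setReg, hv]) (by simp [hs₁, State.setReg])).frame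
  set N := Nat.count (IsCommon G u v) n with hN
  have hNn : N ≤ n := Nat.count_le _
  set r := min N (c + k) with hr
  have hrL : r ^ c ≤ (c + k) ^ c := Nat.pow_le_pow_left (min_le_right _ _) c
  have hrL' := hw.pow
  -- The end of the program is verified first and for arbitrary states, because both branches of the
  -- capping test continue with it.
  have last : ∀ s₄ : State, Ctx c n k m s₄ → Stored ((c + 2) * k + 1) s₄ K → s₄.reg 40 = u →
      s₄.reg 41 = v → s₄.reg 16 = r → s₄.reg 17 = r ^ c →
      (∀ a < n, IsCommon G u v a → s₄.arr 3 (Nat.count (IsCommon G u v) a) = a) →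
      WP w (.forLoop 18 17 (tupleProg c)) s₄ (r ^ c * (tupleTime c + 2) + 2) fun s' =>
        ∃ K', K ⊆ K' ∧ Stored ((c + 2) * k + 1) s' K' ∧
        (∀ y ∈ K', y ∈ K ∨ Forbidden G y) ∧ PairDone c k G K' u v := by
    intro s₄ hc4 hK4 h40 h41 h16 h17 hA
    have kr : ∀ {j}, j < 12 ∨ 14 < j ∧ j < 42 → j ≠ 19 → j ≠ 20 → (tupleProg c).KeepsReg j :=
      tupleProg_keepsReg
    refine WP.forLoop (fun i s => ∃ K', K ⊆ K' ∧ Stored ((c + 2) * k + 1) s K' ∧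
        (∀ y ∈ K', y ∈ K ∨ Forbidden G y) ∧ ∀ q < i, Increasing (tupleOf c u v (s₄.arr 3) r q) →
        Saturated ((c + 2) * k + 1) K' (tupleOf c u v (s₄.arr 3) r q))
      h17 hc4.one (by omega) (by simp) (by simp) (kr (by simp) (by simp) (by simp))
      (kr (by simp) (by simp) (by simp)) (kr (by simp) (by simp) (by simp)) ?_ ?_ ?_
    · exact ⟨K, subset_rfl, hK4.congr rfl rfl, fun y hy => Or.inl hy, by simp⟩
    · intro q s' hq h18 hreg harr ⟨K', hKK', hK', hy, hsat⟩
      -- With no common neighbors the bound `0 ^ c` is `0`, since `c ≠ 0`, and the loop body is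
      -- never entered; so division by `r` is meaningful here.
      have hr0 : 0 < r := Nat.pos_of_ne_zero fun h => by
        rw [h, zero_pow hc0] at hq
        omega
      have h3 : s'.arr 3 = s₄.arr 3 := harr 3 (tupleProg_keepsArr (by simp) (by simp))
      have hc' : ∀ j ≤ 10, s'.reg j = s₄.reg j := fun j hj =>
        hreg j (by omega) (kr (by omega) (by omega) (by omega))
      have hcs : Ctx c n k m s' := hc4.congr hc'
      refine (tupleProg_spec (x := tupleOf c u v (s₄.arr 3) r q) hcs.zero hcs.one hcs.base hcs.thr
        ((hreg 16 (by simp) (kr (by simp) (by simp) (by simp))).trans h16) h18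
        ((hreg 40 (by simp) (kr (by simp) (by simp) (by simp))).trans h40)
        ((hreg 41 (by simp) (kr (by simp) (by simp) (by simp))).trans h41) hr0 ?_ ?_
        (by omega) hw.succ hw.addr hw.thr hw.digits (by omega) hK').mono le_rfl ?_
      · intro t ht
        rw [h3]
        exact (listVertex_spec hA (by omega)).1
      · intro i
        rw [h3]
        have hlt : q / r ^ (i : ℕ) % r < r := Nat.mod_lt _ hr0
        have := (listVertex_spec hA (lt_of_lt_of_le hlt (min_le_left _ _))).1
        simp [tupleOf, listVertex, this]
      · rintro s'' ⟨K'', hK'K'', hK'', hy', hsat'⟩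
        refine ⟨K'', hKK'.trans hK'K'', hK''.congr rfl rfl, fun y hyK => ?_, fun q' hq' hinc => ?_⟩
        · rcases hy' y hyK with h | ⟨rfl, hinc⟩
          · exact hy y h
          · exact Or.inr (forbidden_tupleOf huv hadj hr0
              (fun t ht => (listVertex_spec hA (by omega)).2.1) hinc)
        · rcases Nat.lt_succ_iff_lt_or_eq.1 hq' with hq' | rfl
          · exact (hsat q' hq' hinc).mono hK'K''
          · exact hsat' hinc
    · rintro s' - - ⟨K', hKK', hK', hy, hsat⟩
      exact ⟨K', hKK', hK', hy, pairDone_of_tupleOf hA hr hsat⟩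
  have third : ∀ s₃ : State, Ctx c n k m s₃ → Stored ((c + 2) * k + 1) s₃ K → s₃.reg 40 = u →
      s₃.reg 41 = v → s₃.reg 16 = r →
      (∀ a < n, IsCommon G u v a → s₃.arr 3 (Nat.count (IsCommon G u v) a) = a) →
      WP w (.seq (.block (powBlock 17 16 c)) (.forLoop 18 17 (tupleProg c))) s₃
        (c + 1 + 1 + ((c + k) ^ c * (tupleTime c + 2) + 2)) fun s' =>
        ∃ K', K ⊆ K' ∧ Stored ((c + 2) * k + 1) s' K' ∧
        (∀ y ∈ K', y ∈ K ∨ Forbidden G y) ∧ PairDone c k G K' u v := by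
    intro s₃ hc3 hK3 h40 h41 h16 hA
    obtain ⟨ok, h17⟩ := powBlock_spec (a := 17) (by simp) h16 (w := w) (c := c) (by omega) (by omega)
    have hreg : ∀ j, j ≠ 17 → (runBlock (powBlock 17 16 c) s₃).reg j = s₃.reg j :=
      fun j hj => runBlock_reg (powBlock_keepsReg hj) _
    have harr : ∀ a, (runBlock (powBlock 17 16 c) s₃).arr a = s₃.arr a :=
      fun a => runBlock_arr powBlock_keepsArr _
    refine (WP.seq (WP.block ok (last _ (hc3.congr fun j hj => hreg j (by omega))
      (hK3.congr (harr 4) (harr 5)) ((hreg 40 (by simp)).trans h40)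
      ((hreg 41 (by simp)).trans h41) ((hreg 16 (by simp)).trans h16) h17
      (by rwa [harr])))).mono ?_ fun _ h => h
    have := Nat.mul_le_mul_right (tupleTime c + 2) hrL
    simp only [powBlock, List.length_cons, List.length_replicate]
    omega
  refine (WP.seq (T := 2) (T' := n * 12 + 2 + (3 + (c + 1 + 1 +
    ((c + k) ^ c * (tupleTime c + 2) + 2)))) (WP.block ?_ ?_)).mono (by omega) fun _ h => h
  · simp [BlockOk, Instr.value]
  refine WP.seq (hnb.mono le_rfl ?_)
  rintro s₂ ⟨⟨h16, hA⟩, hreg, harr⟩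
  have kr : ∀ j, j ≠ 11 → j ≠ 12 → j ≠ 13 → j ≠ 16 → s₂.reg j = s.reg j := by
    intro j h11 h12 h13 h16
    rw [hreg j (keepsReg_forLoop.2 ⟨h11, keepsReg_block.2 (neighborBlock_keepsReg h12 h13 h16)⟩)]
    simp [hs₁, State.setReg, h16]
  have ka : ∀ a, a ≠ 3 → s₂.arr a = s.arr a := fun a ha =>
    harr a (keepsArr_forLoop.2 (keepsArr_block.2 (neighborBlock_keepsArr ha)))
  have hc2 : Ctx c n k m s₂ := hc.congr fun j hj =>
    kr j (by omega) (by omega) (by omega) (by omega)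
  have hK2 : Stored ((c + 2) * k + 1) s₂ K := hK.congr (ka 4 (by simp)) (ka 5 (by simp))
  have h40 : s₂.reg 40 = u := (kr 40 (by simp) (by simp) (by simp) (by simp)).trans hu
  have h41 : s₂.reg 41 = v := (kr 41 (by simp) (by simp) (by simp) (by simp)).trans hv
  refine WP.seq (T := 3) (WP.ite (T := 2) (fun hb => ?_) fun hb => ?_)
  · simp only [Test.Holds, hc2.cap, h16] at hb
    refine WP.block ?_ ?_
    · simpa [BlockOk, Instr.value, Op.eval, hc2.cap, hc2.zero] using bcap
    · refine third _ (hc2.congr fun j hj => ?_) (hK2.congr rfl rfl) ?_ ?_ ?_ hA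
      · simp [Instr.apply, State.setReg, show j ≠ 16 by omega]
      · simpa [Instr.apply, State.setReg] using h40
      · simpa [Instr.apply, State.setReg] using h41
      · simp [Instr.apply, State.setReg, Op.eval, hc2.cap, hc2.zero, hr]
        omega
  · simp only [Test.Holds, hc2.cap, h16] at hb
    exact (WP.skip (third _ hc2 hK2 h40 h41 (by omega) hA)).mono (by omega) fun _ h => h

theorem pairProg_spec {w c n k m : ℕ} {G : SimpleGraph (Fin n)} {s : State}
    (hw : Fits w c n k m) (hc : Ctx c n k m s) (hG : AdjStored G s) {u v : Fin n}
    (hu : s.reg 40 = u) (hv : s.reg 41 = v) (huv : v < u) (hc0 : c ≠ 0)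
    {K : Finset (Fin (c + 2) → Fin n)} (hK : Stored ((c + 2) * k + 1) s K) :
    WP w (pairProg c) s (pairTime c n ((c + k) ^ c)) fun s' =>
      ∃ K', K ⊆ K' ∧ Stored ((c + 2) * k + 1) s' K' ∧
      (∀ y ∈ K', y ∈ K ∨ Forbidden G y) ∧ (¬ G.Adj u v → PairDone c k G K' u v) := by
  classical
  have b1 : (u : ℕ) * n ≤ n * n := Nat.mul_le_mul_right _ u.isLt.le
  have b2 := hw.sq
  have b3 := hw.succ
  have b4 : s.arr 2 (u * n + v) ≤ 1 := by
    rw [hG]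
    split_ifs <;> simp
  refine (WP.seq (T := 4) (T' := n * 12 + (c + k) ^ c * (tupleTime c + 2) + c + 14 + 1)
    (WP.block ?_ (WP.ite (fun hb => ?_) fun hb => ?_))).mono ?_ fun _ h => h
  · simp [BlockOk, Instr.value, Instr.apply, State.setReg, Op.eval, hu, hv, hc.verts]
    omega
  · simp only [Test.Holds, runBlock_cons, runBlock_nil, Instr.apply, State.setReg, Op.eval, hu,
      hc.verts] at hb
    simp [hc.zero, hv, hG u v] at hb
    refine (pairBody_spec (s := runBlock [.arith .mul 15 40 2, .arith .add 15 15 41,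
      .load 15 2 15] s) hw (hc.congr fun j hj => ?_) hG ?_ ?_ huv hb hc0
      (hK.congr rfl rfl)).mono le_rfl ?_
    · simp [Instr.apply, State.setReg, show j ≠ 15 by omega]
    · simpa [Instr.apply, State.setReg] using hu
    · simpa [Instr.apply, State.setReg] using hv
    · rintro s' ⟨K', h1, h2, h3, h4⟩
      exact ⟨K', h1, h2, h3, fun _ => h4⟩
  · simp only [Test.Holds, runBlock_cons, runBlock_nil, Instr.apply, State.setReg, Op.eval, hu,
      hc.verts] at hb
    simp [hc.zero, hv, hG u v] at hb
    exact (WP.skip ⟨K, subset_rfl, hK.congr rfl rfl, fun y hy => Or.inl hy,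
      fun h => absurd hb h⟩).mono (by omega) fun _ h => h
  · unfold pairTime
    omega

/-! ### Adjacency matrix and the loop over all pairs -/

/-- Array `A_0` holds the edge list `l`. -/
def InputStored {n : ℕ} (l : List (Fin n × Fin n)) (s : State) : Prop :=
  ∀ (i : ℕ) (h : i < l.length), s.arr 0 (i * 2 + 3) = l[i].1 ∧ s.arr 0 (i * 2 + 3 + 1) = l[i].2

/-- Enter the `R_11`-th edge into the adjacency matrix. -/
def adjBlock : List Instr :=
  [.arith .mul 12 11 9, .arith .add 12 12 10, .load 13 0 12, .arith .add 12 12 1, .load 14 0 12,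
    .arith .mul 15 13 2, .arith .add 15 15 14, .store 2 15 1, .arith .mul 15 14 2,
    .arith .add 15 15 13, .store 2 15 1]

theorem adjBlock_keepsReg {j : ℕ} (h : j < 12) : (Prog.block adjBlock).KeepsReg j :=
  keepsReg_block.2 (by simp [adjBlock, Instr.KeepsReg]; omega)

theorem adjBlock_keepsArr {a : ℕ} (h : a ≠ 2) : (Prog.block adjBlock).KeepsArr a :=
  keepsArr_block.2 (by simp [adjBlock, Instr.KeepsArr, h])

theorem mul_add_inj {n : ℕ} {u v u' v' : Fin n} :
    (u * n + v : ℕ) = u' * n + v' ↔ u = u' ∧ v = v' := by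
  constructor
  · intro h
    have hn : 0 < n := u.pos
    have h1 := congrArg (· / n) h
    have h2 := congrArg (· % n) h
    simp only [Nat.mul_add_mod_self_right, Nat.mod_eq_of_lt v.isLt, Nat.mod_eq_of_lt v'.isLt] at h2
    simp only [mul_comm _ n, Nat.mul_add_div hn, Nat.div_eq_of_lt v.isLt, Nat.div_eq_of_lt v'.isLt,
      add_zero] at h1
    exact ⟨Fin.ext h1, Fin.ext h2⟩
  · rintro ⟨rfl, rfl⟩
    rfl

theorem IsEdgeList.adj_iff {n : ℕ} {G : SimpleGraph (Fin n)} {l : List (Fin n × Fin n)}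
    (h : IsEdgeList G l) (u v : Fin n) :
    G.Adj u v ↔ ∃ e ∈ l, e.1 = u ∧ e.2 = v ∨ e.1 = v ∧ e.2 = u := by
  rw [← h.2]
  simp

/-- Each edge is entered in both orientations, since the list fixes none. Cells for nonadjacent
pairs are correct because the memory starts at zero. -/
theorem adjLoop_spec {w c n k : ℕ} {G : SimpleGraph (Fin n)} {l : List (Fin n × Fin n)}
    (hl : IsEdgeList G l) {s : State} (hw : Fits w c n k l.length) (hc : Ctx c n k l.length s)
    (hin : InputStored l s) (h2 : ∀ a, s.arr 2 a = 0) :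
    WP w (.forLoop 11 4 (.block adjBlock)) s (l.length * 14 + 2) (AdjStored G) := by
  classical
  refine WP.forLoop (T := 12) (fun i s => ∀ a, s.arr 2 a =
      if ∃ e ∈ l.take i, (e.1 * n + e.2 : ℕ) = a ∨ (e.2 * n + e.1 : ℕ) = a then 1 else 0)
    hc.edges hc.one (by have := hw.edges; omega) (by simp) (by simp)
    (adjBlock_keepsReg (by simp)) (adjBlock_keepsReg (by simp)) (adjBlock_keepsReg (by simp)) ?_ ?_ ?_
  · simpa [State.setReg] using h2
  · intro i s' hi h11 hr ha hI
    have hc' : Ctx c n k l.length s' := hc.congr fun j hj =>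
      hr j (by omega) (adjBlock_keepsReg (by omega))
    obtain ⟨g1, g2⟩ := hin i hi
    rw [← ha 0 (adjBlock_keepsArr (by simp))] at g1 g2
    have b1 : (l[i].1 : ℕ) * n ≤ n * n := Nat.mul_le_mul_right _ l[i].1.isLt.le
    have b2 : (l[i].2 : ℕ) * n ≤ n * n := Nat.mul_le_mul_right _ l[i].2.isLt.le
    have b3 := l[i].1.isLt
    have b4 := l[i].2.isLt
    have b5 := hw.sq
    have b6 := hw.edges
    have b7 : w ≠ 0 := by
      rintro rfl
      simp at b6
    refine WP.block ?_ fun a => ?_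
    · simp [adjBlock, BlockOk, Instr.value, Instr.apply, State.setReg, State.setArr, Op.eval,
        h11, hc'.two, hc'.three, hc'.one, hc'.verts, g1, g2]
      omega
    · simp only [adjBlock, runBlock_cons, runBlock_nil, Instr.apply, State.setReg, State.setArr,
        Op.eval, Function.update_apply, h11, hc'.two, hc'.three, hc'.one, hc'.verts]
      simp only [if_true, Nat.reduceEqDiff, if_false, OfNat.one_ne_ofNat, g1, g2,
        Function.update_apply]
      rw [hI a, List.take_succ_eq_append_getElem hi]
      simp only [List.mem_append, List.mem_singleton, or_and_right, exists_or, exists_eq_left]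
      by_cases h1 : (l[i].1 * n + l[i].2 : ℕ) = a
      · simp [h1]
      · by_cases h2 : (l[i].2 * n + l[i].1 : ℕ) = a
        · simp [h2]
        · simp [h1, h2, Ne.symm h1, Ne.symm h2]
  · intro s' _ _ h u v
    rw [h, List.take_length, hl.adj_iff]
    simp only [mul_add_inj]
    congr 1
    simp only [and_comm (a := _ = v)]

/-- Handle all pairs of vertices. -/
noncomputable def pairsLoop (c : ℕ) : Prog := .forLoop 40 2 (.forLoop 41 40 (pairProg c))

theorem pairsLoop_keepsReg {c j : ℕ} (h : j < 11) : (pairsLoop c).KeepsReg j :=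
  keepsReg_forLoop.2 ⟨by omega, keepsReg_forLoop.2 ⟨by omega, pairProg_keepsReg (by omega)⟩⟩

theorem pairsLoop_keepsArr {c a : ℕ} (h3 : a ≠ 3) (h4 : a ≠ 4) (h5 : a ≠ 5) :
    (pairsLoop c).KeepsArr a :=
  keepsArr_forLoop.2 (keepsArr_forLoop.2 (pairProg_keepsArr h3 h4 h5))

/-- The bound of the inner loop is the register holding `u`, so exactly the `v < u` are visited.
Pairs already done remain done by `PairDone.mono`. -/
theorem pairsInner_spec {w c n k m : ℕ} {G : SimpleGraph (Fin n)} {s : State}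
    (hw : Fits w c n k m) (hc : Ctx c n k m s) (hG : AdjStored G s) {u : Fin n}
    (hu : s.reg 40 = u) (hc0 : c ≠ 0)
    {K : Finset (Fin (c + 2) → Fin n)} (hK : Stored ((c + 2) * k + 1) s K) :
    WP w (.forLoop 41 40 (pairProg c)) s (n * (pairTime c n ((c + k) ^ c) + 2) + 2) fun s' =>
      ∃ K', K ⊆ K' ∧ Stored ((c + 2) * k + 1) s' K' ∧
      (∀ y ∈ K', y ∈ K ∨ Forbidden G y) ∧ ∀ v < u, ¬ G.Adj u v → PairDone c k G K' u v := by
  refine (WP.forLoop (T := pairTime c n ((c + k) ^ c)) (fun i s => ∃ K', K ⊆ K' ∧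
      Stored ((c + 2) * k + 1) s K' ∧ (∀ y ∈ K', y ∈ K ∨ Forbidden G y) ∧
      ∀ v : Fin n, (v : ℕ) < i → ¬ G.Adj u v → PairDone c k G K' u v)
    hu hc.one (by have := hw.succ; omega) (by simp) (by simp)
    (pairProg_keepsReg (by simp)) (pairProg_keepsReg (by simp)) (pairProg_keepsReg (by simp))
    ?_ ?_ ?_).mono (Nat.add_le_add_right (Nat.mul_le_mul_right _ u.isLt.le) _) fun _ h => h
  · exact ⟨K, subset_rfl, hK.congr rfl rfl, fun y hy => Or.inl hy, by simp⟩
  · intro i s' hi h41 hr ha ⟨K', h1, h2, h3, h4⟩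
    have kr : ∀ j, j < 11 ∨ j = 40 → s'.reg j = s.reg j := fun j hj =>
      hr j (by omega) (pairProg_keepsReg (by omega))
    have hG' : AdjStored G s' := by
      unfold AdjStored
      rw [ha 2 (pairProg_keepsArr (by simp) (by simp) (by simp))]
      exact hG
    refine (pairProg_spec (v := ⟨i, by omega⟩) hw (hc.congr fun j hj => kr j (by omega)) hG'
      ((kr 40 (by simp)).trans hu) h41 hi hc0 h2).mono le_rfl ?_
    rintro s'' ⟨K'', h5, h6, h7, h8⟩
    refine ⟨K'', h1.trans h5, h6.congr rfl rfl, fun y hy => ?_, fun v hv hadj => ?_⟩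
    · exact (h7 y hy).elim (h3 y) Or.inr
    · rcases Nat.lt_succ_iff_lt_or_eq.1 hv with hv | rfl
      · exact (h4 v hv hadj).mono h5
      · exact h8 hadj
  · rintro s' - - ⟨K', h1, h2, h3, h4⟩
    exact ⟨K', h1, h2, h3, fun v hv => h4 v hv⟩

/-- Zeroed counters and marks already represent the empty family, so no time is spent on
initializing the large counter array. -/
theorem pairsLoop_spec {w c n k m : ℕ} {G : SimpleGraph (Fin n)} {s : State}
    (hw : Fits w c n k m) (hc : Ctx c n k m s) (hG : AdjStored G s) (hc0 : c ≠ 0)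
    (h4 : ∀ a, s.arr 4 a = 0) (h5 : ∀ a, s.arr 5 a = 0) :
    WP w (pairsLoop c) s (n * (n * (pairTime c n ((c + k) ^ c) + 2) + 2 + 2) + 2) fun s' =>
      ∃ K : Finset (Fin (c + 2) → Fin n), Stored ((c + 2) * k + 1) s' K ∧
      (∀ y ∈ K, Forbidden G y) ∧ ∀ u v, v < u → ¬ G.Adj u v → PairDone c k G K u v := by
  have kr' : ∀ j, j < 11 ∨ j = 40 → (Prog.forLoop 41 40 (pairProg c)).KeepsReg j := fun j hj =>
    keepsReg_forLoop.2 ⟨by omega, pairProg_keepsReg (by omega)⟩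
  refine (WP.forLoop (T := n * (pairTime c n ((c + k) ^ c) + 2) + 2) (fun i s =>
      ∃ K : Finset (Fin (c + 2) → Fin n), Stored ((c + 2) * k + 1) s K ∧
      (∀ y ∈ K, Forbidden G y) ∧
      ∀ u v : Fin n, (u : ℕ) < i → v < u → ¬ G.Adj u v → PairDone c k G K u v)
    hc.verts hc.one (by have := hw.succ; omega) (by simp) (by simp)
    (kr' _ (by simp)) (kr' _ (by simp)) (kr' _ (by simp)) ?_ ?_ ?_)
  · exact ⟨∅, ⟨sparse_empty _, by simp [State.setReg, h4, agreeCount],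
      by simp [State.setReg, h5]⟩, by simp, by simp⟩
  · intro i s' hi h40 hr ha ⟨K, h1, h2, h3⟩
    have hG' : AdjStored G s' := by
      unfold AdjStored
      rw [ha 2 (keepsArr_forLoop.2 (pairProg_keepsArr (by simp) (by simp) (by simp)))]
      exact hG
    refine (pairsInner_spec (u := ⟨i, hi⟩) hw
      (hc.congr fun j hj => hr j (by omega) (kr' j (by omega))) hG' h40 hc0 h1).mono le_rfl ?_
    rintro s'' ⟨K', g1, g2, g3, g4⟩
    refine ⟨K', g2.congr rfl rfl, fun y hy => (g3 y hy).elim (h2 y) id, fun u v hu huv hadj => ?_⟩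
    rcases Nat.lt_succ_iff_lt_or_eq.1 hu with hu | rfl
    · exact (h3 u v hu huv hadj).mono g1
    · exact g4 v huv hadj
  · rintro s' - - ⟨K, h1, h2, h3⟩
    exact ⟨K, h1, h2, fun u v => h3 u v u.isLt⟩

/-! ### Input and output encodings, and writing the induced subgraph -/

theorem flatMap_pair_getElem? {α : Type*} (f g : α → ℕ) (l : List α) (j : ℕ) :
    (l.flatMap fun e => [f e, g e])[j * 2]? = l[j]?.map f ∧
    (l.flatMap fun e => [f e, g e])[j * 2 + 1]? = l[j]?.map g := by
  induction l generalizing j with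
  | nil => simp
  | cons e l ih =>
    rcases j with _ | j
    · simp
    · have h1 : (j + 1) * 2 = j * 2 + 1 + 1 := by ring
      simpa [h1] using ih j

theorem length_encode {n k : ℕ} (l : List (Fin n × Fin n)) :
    (encode n k l).length = l.length * 2 + 3 := by
  simp [encode]

theorem encode_getElem? {n k : ℕ} (l : List (Fin n × Fin n)) (j : ℕ) :
    (encode n k l)[j * 2 + 3]? = l[j]?.map (fun e => (e.1 : ℕ)) ∧
    (encode n k l)[j * 2 + 3 + 1]? = l[j]?.map (fun e => (e.2 : ℕ)) := by
  have := flatMap_pair_getElem? (fun e : Fin n × Fin n => (e.1 : ℕ)) (fun e => (e.2 : ℕ)) l j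
  simpa [encode] using this

theorem inputStored_init {n k : ℕ} (l : List (Fin n × Fin n)) :
    InputStored l (State.init (encode n k l)) := by
  intro j hj
  obtain ⟨h1, h2⟩ := encode_getElem? (k := k) l j
  simp only [State.init, if_true, List.getD_eq_getElem?_getD]
  rw [h1, h2]
  simp [hj]

theorem outputs_encode {n k : ℕ} {l : List (Fin n × Fin n)} {s : State} (h0 : s.arr 1 0 = n)
    (h1 : s.arr 1 1 = k) (h2 : s.arr 1 2 = l.length)
    (h : ∀ (j : ℕ) (hj : j < l.length),
      s.arr 1 (j * 2 + 3) = l[j].1 ∧ s.arr 1 (j * 2 + 3 + 1) = l[j].2) :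
    s.Outputs (encode n k l) := by
  intro i hi
  rw [length_encode] at hi
  match i with
  | 0 => simpa [encode] using h0
  | 1 => simpa [encode] using h1
  | 2 => simpa [encode] using h2
  | i + 3 =>
    have hj : i / 2 < l.length := by omega
    obtain ⟨e1, e2⟩ := encode_getElem? (k := k) l (i / 2)
    obtain ⟨g1, g2⟩ := h (i / 2) hj
    rw [List.getElem?_eq_getElem hj, Option.map_some, List.getElem?_eq_some_iff] at e1 e2
    obtain ⟨_, e1⟩ := e1
    obtain ⟨_, e2⟩ := e2
    rcases Nat.mod_two_eq_zero_or_one i with hm | hm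
    · have hi' : i + 3 = i / 2 * 2 + 3 := by omega
      simp only [hi', g1, e1]
    · have hi' : i + 3 = i / 2 * 2 + 3 + 1 := by omega
      simp only [hi', g2, e2]

/-- Give the vertex `R_11` its number among the marked vertices. -/
def rankBlock : List Instr := [.store 6 11 16, .load 12 5 11, .arith .add 16 16 12]

open scoped Classical in
-- The new name of a marked vertex is the number of marked vertices before it. Marks are `0` or `1`,
-- so adding them up counts.
theorem rankLoop_spec {w c n k m : ℕ} {s : State} (hw : Fits w c n k m) (hc : Ctx c n k m s)
    (h16 : s.reg 16 = 0) (h5 : ∀ a < n, s.arr 5 a ≤ 1) :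
    WP w (.forLoop 11 2 (.block rankBlock)) s (n * 6 + 2) fun s' =>
      s'.reg 16 = Nat.count (fun a => s.arr 5 a = 1) n ∧
      ∀ a < n, s'.arr 6 a = Nat.count (fun a => s.arr 5 a = 1) a := by
  have kr : ∀ {j}, j < 12 → (Prog.block rankBlock).KeepsReg j := fun h =>
    keepsReg_block.2 (by simp [rankBlock, Instr.KeepsReg]; omega)
  refine WP.forLoop (T := 4) (fun i s' => s'.reg 16 = Nat.count (fun a => s.arr 5 a = 1) i ∧
      ∀ a < i, s'.arr 6 a = Nat.count (fun a => s.arr 5 a = 1) a)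
    hc.verts hc.one (by have := hw.succ; omega) (by simp) (by simp) (kr (by simp)) (kr (by simp))
    (kr (by simp)) ?_ ?_ fun _ _ _ h => h
  · simp [State.setReg, h16]
  · intro i s' hi h11 _ ha ⟨hI, hI'⟩
    have a5 : s'.arr 5 = s.arr 5 := ha 5 (keepsArr_block.2 (by simp [rankBlock, Instr.KeepsArr]))
    have hle : Nat.count (fun a => s.arr 5 a = 1) i ≤ i := Nat.count_le _
    have h5i := h5 i hi
    have b1 := hw.succ
    refine WP.block ?_ ⟨?_, fun a hai => ?_⟩
    · simp [rankBlock, BlockOk, Instr.value, Instr.apply, State.setReg, State.setArr, Op.eval,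
        h11, hI, a5]
      omega
    · simp [rankBlock, Instr.apply, State.setReg, State.setArr, Op.eval, h11, hI, a5,
        Nat.count_succ]
      split_ifs <;> omega
    · simp only [rankBlock, runBlock_cons, runBlock_nil, Instr.apply, State.setReg, State.setArr,
        Op.eval, Function.update_apply, h11, hI]
      rcases Nat.lt_succ_iff_lt_or_eq.1 hai with hai | rfl
      · simp [hai.ne, hI' a hai]
      · simp

/-- Append the `R_11`-th edge to the output if both endpoints are marked. -/
def outBlock : List Instr :=
  [.arith .mul 12 11 9, .arith .add 12 12 10, .load 13 0 12, .arith .add 12 12 1, .load 14 0 12,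
    .load 15 6 13, .arith .mul 18 17 9, .arith .add 18 18 10, .store 1 18 15, .load 15 6 14,
    .arith .add 18 18 1, .store 1 18 15, .load 13 5 13, .load 14 5 14, .arith .mul 13 13 14,
    .arith .add 17 17 13]

/-- `F` abstracts the relabelling of edges and is undefined unless both ends are marked. Every edge
is written at the current end of the output, but the end advances only by the product of the two
marks, so discarded edges are overwritten or lie beyond the output. -/
theorem outLoop_spec {w c n n' k : ℕ} {l : List (Fin n × Fin n)}
    {s : State} (hw : Fits w c n k l.length) (hc : Ctx c n k l.length s)
    (hin : InputStored l s) (h17 : s.reg 17 = 0) (h6 : ∀ a < n, s.arr 6 a ≤ n)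
    (F : Fin n × Fin n → Option (Fin n' × Fin n'))
    (hsome : ∀ e a, F e = some a → s.arr 5 e.1 = 1 ∧ s.arr 5 e.2 = 1 ∧ s.arr 6 e.1 = a.1 ∧
      s.arr 6 e.2 = a.2)
    (hnone : ∀ e, F e = none → s.arr 5 e.1 ≤ 1 ∧ s.arr 5 e.2 ≤ 1 ∧
      s.arr 5 e.1 * s.arr 5 e.2 = 0) :
    WP w (.forLoop 11 4 (.block outBlock)) s (l.length * 19 + 2) fun s' =>
      s'.reg 17 = (l.filterMap F).length ∧ s'.arr 1 0 = s.arr 1 0 ∧ s'.arr 1 1 = s.arr 1 1 ∧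
      ∀ (j : ℕ) (hj : j < (l.filterMap F).length), s'.arr 1 (j * 2 + 3) = (l.filterMap F)[j].1 ∧
        s'.arr 1 (j * 2 + 3 + 1) = (l.filterMap F)[j].2 := by
  have kr : ∀ {j}, j < 12 → (Prog.block outBlock).KeepsReg j := fun h =>
    keepsReg_block.2 (by simp [outBlock, Instr.KeepsReg]; omega)
  have ka : ∀ {a}, a ≠ 1 → (Prog.block outBlock).KeepsArr a := fun h =>
    keepsArr_block.2 (by simp [outBlock, Instr.KeepsArr, h])
  refine WP.forLoop (T := 17) (fun i s' => s'.reg 17 = ((l.take i).filterMap F).length ∧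
      s'.arr 1 0 = s.arr 1 0 ∧ s'.arr 1 1 = s.arr 1 1 ∧
      ∀ (j : ℕ) (hj : j < ((l.take i).filterMap F).length),
        s'.arr 1 (j * 2 + 3) = ((l.take i).filterMap F)[j].1 ∧
        s'.arr 1 (j * 2 + 3 + 1) = ((l.take i).filterMap F)[j].2)
    hc.edges hc.one (by have := hw.edges; omega) (by simp) (by simp) (kr (by simp)) (kr (by simp))
    (kr (by simp)) ?_ ?_ fun s' _ _ h => by simpa using h
  · simp [State.setReg, h17]
  · intro i s' hi h11 hr ha ⟨hI, hI0, hI1, hI'⟩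
    have hc' : Ctx c n k l.length s' := hc.congr fun j hj => hr j (by omega) (kr (by omega))
    obtain ⟨g1, g2⟩ := hin i hi
    rw [← ha 0 (ka (by simp))] at g1 g2
    have a5 : s'.arr 5 = s.arr 5 := ha 5 (ka (by simp))
    have a6 : s'.arr 6 = s.arr 6 := ha 6 (ka (by simp))
    set out := (l.take i).filterMap F with hout
    have hlen : out.length ≤ i := by
      refine (List.length_filterMap_le _ _).trans ?_
      simp
    have b1 := hw.edges
    have b2 := hw.succ
    have b3 := h6 _ l[i].1.isLt
    have b4 := h6 _ l[i].2.isLt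
    have b5 := l[i].1.isLt
    have b6 := l[i].2.isLt
    have hF : ∃ z ≤ 1, s.arr 5 l[i].1 ≤ 1 ∧ s.arr 5 l[i].2 ≤ 1 ∧
        s.arr 5 l[i].1 * s.arr 5 l[i].2 = z ∧
        ((z = 0 ∧ (l.take (i + 1)).filterMap F = out) ∨ (z = 1 ∧ ∃ a : Fin n' × Fin n',
          s.arr 6 l[i].1 = a.1 ∧ s.arr 6 l[i].2 = a.2 ∧
          (l.take (i + 1)).filterMap F = out ++ [a])) := by
      rw [List.take_succ_eq_append_getElem hi, List.filterMap_append]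
      rcases hFe : F l[i] with _ | a
      · obtain ⟨h1, h2, h3⟩ := hnone _ hFe
        exact ⟨0, by simp, h1, h2, h3, Or.inl ⟨rfl, by simp [hFe, hout]⟩⟩
      · obtain ⟨h1, h2, h3, h4⟩ := hsome _ _ hFe
        exact ⟨1, by simp, by simp [h1], by simp [h2], by simp [h1, h2],
          Or.inr ⟨rfl, a, h3, h4, by simp [hFe, hout]⟩⟩
    obtain ⟨z, hz, h1, h2, h3, hF⟩ := hF
    set s'' := runBlock outBlock s' with hs''
    have e17 : s''.reg 17 = out.length + z := by
      simp [hs'', outBlock, Instr.apply, State.setReg, State.setArr, Op.eval,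
        h11, hc'.two, hc'.three, hc'.one, g1, g2, a5, a6, hI, h3]
    have earr : ∀ a, s''.arr 1 a = if a = out.length * 2 + 3 + 1 then s.arr 6 l[i].2 else
        if a = out.length * 2 + 3 then s.arr 6 l[i].1 else s'.arr 1 a := by
      intro a
      simp [hs'', outBlock, Instr.apply, State.setReg, State.setArr, Op.eval,
        h11, hc'.two, hc'.three, hc'.one, g1, g2, a5, a6, hI, h3, Function.update_apply]
    refine WP.block ?_ ?_
    · simp [outBlock, BlockOk, Instr.value, Instr.apply, State.setReg, State.setArr, Op.eval,
        h11, hc'.two, hc'.three, hc'.one, g1, g2, a5, a6, hI, h3]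
      omega
    · change s''.reg 17 = _ ∧ s''.arr 1 0 = _ ∧ s''.arr 1 1 = _ ∧ ∀ j hj,
        s''.arr 1 (j * 2 + 3) = _ ∧ s''.arr 1 (j * 2 + 3 + 1) = _
      rw [e17, earr, earr, if_neg (by omega), if_neg (by omega), if_neg (by omega),
        if_neg (by omega)]
      have old : ∀ (j : ℕ) (hj : j < out.length), s''.arr 1 (j * 2 + 3) = out[j].1 ∧
          s''.arr 1 (j * 2 + 3 + 1) = out[j].2 := by
        intro j hj
        rw [earr, earr, if_neg (by omega), if_neg (by omega), if_neg (by omega),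
          if_neg (by omega)]
        exact hI' j hj
      rcases hF with ⟨rfl, hF⟩ | ⟨rfl, a, h6, h7, hF⟩
      · simp only [hF]
        exact ⟨rfl, hI0, hI1, old⟩
      · simp only [hF]
        refine ⟨by simp, hI0, hI1, fun j hj => ?_⟩
        rw [List.length_append, List.length_singleton] at hj
        rcases Nat.lt_succ_iff_lt_or_eq.1 hj with hj | rfl
        · rw [List.getElem_append_left hj]
          exact old j hj
        · rw [earr, earr]
          simp [h6, h7]

/-- Write the subgraph induced by the marked vertices to the output. -/
def outputProg : Prog :=
  .seq (.block [.const 16 0]) <| .seq (.forLoop 11 2 (.block rankBlock)) <|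
    .seq (.block [.store 1 0 16, .store 1 1 3, .const 17 0]) <|
    .seq (.forLoop 11 4 (.block outBlock)) (.block [.store 1 9 17])

/-- Mapped back through `e`, the filtered list is a sublist of `l`, so it inherits the absence of
repeated edges. -/
theorem isEdgeList_comap {n n' : ℕ} {G : SimpleGraph (Fin n)} {l : List (Fin n × Fin n)}
    (hl : IsEdgeList G l) (e : Fin n' ↪ Fin n) (F : Fin n × Fin n → Option (Fin n' × Fin n'))
    (hF : ∀ x a, F x = some a ↔ x = (e a.1, e a.2)) : IsEdgeList (G.comap e) (l.filterMap F) := by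
  refine ⟨?_, fun u v => ?_⟩
  · have hsub : ((l.filterMap F).map fun a => (e a.1, e a.2)).Sublist l := by
      clear hl
      induction l with
      | nil => simp
      | cons x l ih =>
        rcases hx : F x with _ | a
        · rw [List.filterMap_cons_none hx]
          exact ih.cons x
        · rw [List.filterMap_cons_some hx, List.map_cons, ← (hF x a).1 hx]
          exact ih.cons_cons x
    have h := (hsub.map fun x => s(x.1, x.2)).nodup hl.1
    rw [List.map_map] at h
    refine List.Nodup.of_map (Sym2.map e) ?_
    rw [List.map_map]
    exact h
  · rw [SimpleGraph.comap_adj, hl.adj_iff]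
    simp only [List.mem_map, List.mem_filterMap, hF]
    constructor
    · rintro ⟨a, ⟨x, hx, rfl⟩, ha⟩
      refine ⟨_, hx, ?_⟩
      rcases Sym2.eq_iff.1 ha with ⟨h1, h2⟩ | ⟨h1, h2⟩ <;> simp [h1, h2]
    · rintro ⟨x, hx, h⟩
      rcases h with ⟨h1, h2⟩ | ⟨h1, h2⟩
      · exact ⟨(u, v), ⟨x, hx, Prod.ext h1 h2⟩, rfl⟩
      · exact ⟨(v, u), ⟨x, hx, Prod.ext h1 h2⟩, Sym2.eq_swap⟩

theorem exists_rank_embedding (n : ℕ) (p : ℕ → Prop) [DecidablePred p] :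
    ∃ e : Fin (Nat.count p n) ↪ Fin n, (∀ w, p (e w) ∧ Nat.count p (e w) = w) ∧
      ∀ v : Fin n, p v → ∃ w, e w = v := by
  have key : ∀ w : Fin (Nat.count p n), ∃ v : Fin n, p v ∧ Nat.count p v = w := by
    intro w
    have hfin : ∀ hf : (Set.ofPred p).Finite, (w : ℕ) < hf.toFinset.card :=
      fun hf => w.isLt.trans_le (Nat.count_le_card hf n)
    exact ⟨⟨Nat.nth p w, Nat.nth_lt_of_lt_count w.isLt⟩, Nat.nth_mem _ hfin, Nat.count_nth hfin⟩
  choose e he using key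
  refine ⟨⟨e, fun a b hab => ?_⟩, he, fun v hv => ?_⟩
  · rw [Fin.ext_iff, ← (he a).2, ← (he b).2, hab]
  · refine ⟨⟨Nat.count p v, Nat.count_strict_mono hv v.isLt⟩, Fin.ext ?_⟩
    exact Nat.count_injective (he _).1 hv (he _).2

open scoped Classical in
theorem outputProg_spec {w c n k : ℕ} {G : SimpleGraph (Fin n)} {l : List (Fin n × Fin n)}
    (hl : IsEdgeList G l) {s : State} (hw : Fits w c n k l.length) (hc : Ctx c n k l.length s)
    (hk : k < 2 ^ w) (hin : InputStored l s) (h5 : ∀ a < n, s.arr 5 a ≤ 1) :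
    WP w outputProg s (n * 6 + l.length * 19 + 12) fun s' =>
      ∃ e : Fin (Nat.count (fun a => s.arr 5 a = 1) n) ↪ Fin n,
        (∀ v : Fin n, s.arr 5 v = 1 → ∃ w, e w = v) ∧
        ∃ l', IsEdgeList (G.comap e) l' ∧
          s'.Outputs (encode (Nat.count (fun a => s.arr 5 a = 1) n) k l') := by
  set p : ℕ → Prop := fun a => s.arr 5 a = 1 with hp
  set n' := Nat.count p n with hn'
  obtain ⟨e, he, hsurj⟩ : ∃ e : Fin n' ↪ Fin n, (∀ w, p (e w) ∧ Nat.count p (e w) = w) ∧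
      ∀ v : Fin n, p v → ∃ w, e w = v := exists_rank_embedding n p
  have hn'n : n' ≤ n := Nat.count_le _
  have b1 := hw.succ
  -- The partial inverse of `e` on pairs; it is well defined because `e` is injective.
  let F : Fin n × Fin n → Option (Fin n' × Fin n') := fun x =>
    if h : ∃ a : Fin n' × Fin n', x = (e a.1, e a.2) then some h.choose else none
  have hF : ∀ x a, F x = some a ↔ x = (e a.1, e a.2) := by
    intro x a
    by_cases h : ∃ a : Fin n' × Fin n', x = (e a.1, e a.2)
    · have h' := h.choose_spec
      simp only [F, dif_pos h, Option.some_inj]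
      constructor
      · rintro rfl
        exact h'
      · intro hx
        have h'' := Prod.mk.inj (h'.symm.trans hx)
        exact Prod.ext (e.injective h''.1) (e.injective h''.2)
    · simp only [F, dif_neg h, reduceCtorEq, false_iff]
      exact fun hx => h ⟨a, hx⟩
  have hnone : ∀ x, F x = none → ¬ (p x.1 ∧ p x.2) := by
    rintro x hx ⟨h1, h2⟩
    obtain ⟨a, ha⟩ := hsurj _ h1
    obtain ⟨b, hb⟩ := hsurj _ h2
    rw [(hF x (a, b)).2 (by simp [ha, hb])] at hx
    exact absurd hx (by simp)
  set s₁ := s.setReg 16 0 with hs₁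
  have hc1 : Ctx c n k l.length s₁ := hc.congr fun j hj => by
    simp [hs₁, State.setReg, show j ≠ 16 by omega]
  refine (WP.seq (T := 2) (T' := n * 6 + 2 + (4 + (l.length * 19 + 2 + 2))) (WP.block ?_
    (WP.seq ((rankLoop_spec hw hc1 (by simp [hs₁, State.setReg]) h5).frame.mono le_rfl ?_)))).mono
    (by omega) fun _ h => h
  · simp [BlockOk, Instr.value]
  rintro s₂ ⟨⟨h16, h6⟩, hreg, harr⟩
  have kr : ∀ j ≤ 10, s₂.reg j = s₁.reg j := fun j hj => hreg j (keepsReg_forLoop.2 ⟨by omega,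
    keepsReg_block.2 (by simp [rankBlock, Instr.KeepsReg]; omega)⟩)
  have ka : ∀ a, a ≠ 6 → s₂.arr a = s.arr a := fun a ha =>
    harr a (keepsArr_forLoop.2 (keepsArr_block.2 (by simp [rankBlock, Instr.KeepsArr, ha])))
  have hc2 : Ctx c n k l.length s₂ := hc1.congr kr
  replace h16 : s₂.reg 16 = n' := h16
  replace h6 : ∀ a < n, s₂.arr 6 a = Nat.count p a := h6
  refine WP.seq (WP.block ?_ ?_)
  · simp [BlockOk, Instr.value, Instr.apply, State.setArr, h16, hc2.param, hk]
    omega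
  set s₃ := runBlock [.store 1 0 16, .store 1 1 3, .const 17 0] s₂ with hs₃
  have hc3 : Ctx c n k l.length s₃ := hc2.congr fun j hj => by
    simp [hs₃, Instr.apply, State.setReg, State.setArr, show j ≠ 17 by omega]
  have ka3 : ∀ a, a ≠ 1 → s₃.arr a = s₂.arr a := fun a ha =>
    runBlock_arr (by simp [Instr.KeepsArr, ha]) s₂
  have e10 : s₃.arr 1 0 = n' := by
    simp [hs₃, Instr.apply, State.setReg, State.setArr, hc2.zero, hc2.one, h16]
  have e11 : s₃.arr 1 1 = k := by
    simp [hs₃, Instr.apply, State.setReg, State.setArr, hc2.one, hc2.param]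
  have a5 : s₃.arr 5 = s.arr 5 := (ka3 5 (by simp)).trans (ka 5 (by simp))
  have a6 : s₃.arr 6 = s₂.arr 6 := ka3 6 (by simp)
  have a0 : s₃.arr 0 = s.arr 0 := (ka3 0 (by simp)).trans (ka 0 (by simp))
  refine WP.seq ((outLoop_spec hw hc3 (by unfold InputStored; rwa [a0])
    (by simp [hs₃, Instr.apply, State.setReg]) (fun a ha => ?_) F (fun x a hx => ?_)
    (fun x hx => ?_)).frame.mono le_rfl ?_)
  · rw [a6, h6 a ha]
    exact (Nat.count_le _).trans ha.le
  · rw [hF] at hx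
    subst hx
    simp only [a5, a6]
    rw [h6 _ (Fin.isLt _), h6 _ (Fin.isLt _)]
    exact ⟨(he _).1, (he _).1, (he _).2, (he _).2⟩
  · rw [a5]
    have h1 := h5 x.1 x.1.isLt
    have h2 := h5 x.2 x.2.isLt
    refine ⟨h1, h2, ?_⟩
    have h3 := hnone x hx
    simp only [hp] at h3
    rw [Nat.mul_eq_zero]
    omega
  · rintro s₄ ⟨⟨h17, h10, h11, hout⟩, hreg4, -⟩
    have r4 : ∀ j ≤ 10, s₄.reg j = s₃.reg j := fun j hj => hreg4 j (keepsReg_forLoop.2 ⟨by omega,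
      keepsReg_block.2 (by simp [outBlock, Instr.KeepsReg]; omega)⟩)
    have hc4 := hc3.congr r4
    have hlen := List.length_filterMap_le F l
    have b3 := hw.edges
    refine WP.block ?_ ⟨e, hsurj, l.filterMap F, isEdgeList_comap hl e F hF, ?_⟩
    · simp [BlockOk, Instr.value, h17]
      omega
    · have harr : ∀ a, (runBlock [.store 1 9 17] s₄).arr 1 a =
          if a = 2 then (l.filterMap F).length else s₄.arr 1 a := by
        intro a
        simp [Instr.apply, State.setArr, hc4.two, h17, Function.update_apply]
      refine outputs_encode ?_ ?_ ?_ fun j hj => ?_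
      · rw [harr, if_neg (by simp), h10, e10]
      · rw [harr, if_neg (by simp), h11, e11]
      · rw [harr, if_pos rfl]
      · rw [harr, harr, if_neg (by omega), if_neg (by omega)]
        exact hout j hj

/-- Copy the input to the output. -/
def copyProg : Prog :=
  .seq (.block [.arith .mul 12 4 9, .arith .add 12 12 10])
    (.forLoop 11 12 (.block [.load 13 0 11, .store 1 11 13]))

theorem copyProg_spec {w c n k m : ℕ} {s : State} (hw : Fits w c n k m) (hc : Ctx c n k m s)
    (h0 : ∀ a < m * 2 + 3, s.arr 0 a < 2 ^ w) :
    WP w copyProg s (m * 10 + 20) fun s' => ∀ a < m * 2 + 3, s'.arr 1 a = s.arr 0 a := by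
  have b1 := hw.edges
  have kr : ∀ {j}, j ≠ 13 → (Prog.block [.load 13 0 11, .store 1 11 13]).KeepsReg j := fun h =>
    keepsReg_block.2 (by simp [Instr.KeepsReg, h])
  set s₁ := runBlock [.arith .mul 12 4 9, .arith .add 12 12 10] s with hs₁
  have e12 : s₁.reg 12 = m * 2 + 3 := by
    simp [hs₁, Instr.apply, State.setReg, Op.eval, hc.edges, hc.two, hc.three]
  have e1 : s₁.reg 1 = 1 := by
    simp [hs₁, Instr.apply, State.setReg, hc.one]
  refine (WP.seq (T := 3) (WP.block ?_ (WP.forLoop (N := m * 2 + 3) (T := 3)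
    (fun i s' => ∀ a < i, s'.arr 1 a = s.arr 0 a) e12 e1 (by omega) (by simp) (by simp)
    (kr (by simp)) (kr (by simp)) (kr (by simp)) (by simp) ?_ fun _ _ _ h => h))).mono
    (by omega) fun _ h => h
  · simp [BlockOk, Instr.value, Instr.apply, State.setReg, Op.eval, hc.edges, hc.two, hc.three]
    omega
  · intro i s' hi h11 _ ha hI
    have a0 : s'.arr 0 = s.arr 0 :=
      ha 0 (keepsArr_block.2 (by simp [Instr.KeepsArr]))
    refine WP.block ?_ fun a hai => ?_
    · simpa [BlockOk, Instr.value, Instr.apply, State.setReg, h11, a0] using h0 i hi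
    · simp only [runBlock_cons, runBlock_nil, Instr.apply, State.setReg, State.setArr,
        Function.update_apply, h11, a0]
      rcases Nat.lt_succ_iff_lt_or_eq.1 hai with hai | rfl
      · simp [hai.ne, hI a hai]
      · simp

/-! ### The complete algorithm: word length, size and running time -/

/-- Load the input and compute the constants. -/
def setupBlock (c : ℕ) : List Instr :=
  [.const 1 1, .load 2 0 0, .load 3 0 1, .const 9 2, .load 4 0 9, .arith .add 5 2 1, .const 10 3,
    .const 6 (c + 2), .arith .mul 6 6 3, .arith .add 6 6 1, .const 7 c, .arith .add 7 7 3] ++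
    powBlock 8 7 c

/-- The kernelization algorithm. -/
noncomputable def kernelProg (c : ℕ) : Prog :=
  .seq (.block (setupBlock c)) <|
    .ite (.lt 8 2) (.seq (.forLoop 11 4 (.block adjBlock)) (.seq (pairsLoop c) outputProg)) copyProg

theorem setup_spec {w c n k : ℕ} {l : List (Fin n × Fin n)} (hw : Fits w c n k l.length)
    (hk : 1 ≤ k) :
    BlockOk w (setupBlock c) (State.init (encode n k l)) ∧
    Ctx c n k l.length (runBlock (setupBlock c) (State.init (encode n k l))) ∧
    (runBlock (setupBlock c) (State.init (encode n k l))).reg 8 = (c + k) ^ c ∧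
    ∀ a, (runBlock (setupBlock c) (State.init (encode n k l))).arr a =
      (State.init (encode n k l)).arr a := by
  set s := State.init (encode n k l) with hs
  have hr : ∀ i, s.reg i = 0 := fun i => rfl
  have a0 : s.arr 0 0 = n := by simp [hs, State.init, encode]
  have a1 : s.arr 0 1 = k := by simp [hs, State.init, encode]
  have a2 : s.arr 0 2 = l.length := by simp [hs, State.init, encode]
  have b1 := hw.succ
  have b2 := hw.edges
  have b3 := hw.cap
  have b4 : (c + 2) * k + 1 < 2 ^ w := by
    have h1 := Nat.le_self_pow (n := c + 2) (by simp) ((c + 2) * k + 1)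
    have h2 := hw.thr
    have h3 : 0 < (masks (c + 2)).length := List.length_pos_of_mem (a := ∅) (by simp [masks])
    omega
  have b5 : c + 2 ≤ (c + 2) * k := Nat.le_mul_of_pos_right _ hk
  have b6 : w ≠ 0 := by
    rintro rfl
    simp at b1
  set pre : List Instr := [.const 1 1, .load 2 0 0, .load 3 0 1, .const 9 2, .load 4 0 9,
    .arith .add 5 2 1, .const 10 3, .const 6 (c + 2), .arith .mul 6 6 3, .arith .add 6 6 1,
    .const 7 c, .arith .add 7 7 3] with hpre
  set s₁ := runBlock pre s with hs₁
  have ok : BlockOk w pre s := by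
    simp [hpre, BlockOk, Instr.value, Instr.apply, State.setReg, Op.eval, hr, a0, a1, a2]
    omega
  have c1 : Ctx c n k l.length s₁ := by
    constructor <;>
      simp [hs₁, hpre, Instr.apply, State.setReg, Op.eval, hr, a0, a1, a2]
  obtain ⟨ok2, h8⟩ := powBlock_spec (w := w) (a := 8) (by simp) c1.cap hw.pow (by omega)
  refine ⟨(blockOk_append _ _ _).2 ⟨ok, ok2⟩, ?_, ?_, fun a => ?_⟩
  · rw [setupBlock, runBlock_append]
    constructor <;> rw [runBlock_reg (powBlock_keepsReg (by simp))]
    exacts [c1.zero, c1.one, c1.verts, c1.param, c1.edges, c1.base, c1.thr, c1.cap, c1.two,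
      c1.three]
  · rw [setupBlock, runBlock_append]
    exact h8
  · exact runBlock_arr (List.forall_mem_append.2
      ⟨by simp [Instr.KeepsArr], powBlock_keepsArr⟩) s

/-- Let `Y = 2 ^ Nat.size (n + k)`, which exceeds `n + k`. Every number involved is polynomial in
`n` and `k` with coefficients depending on `c`, hence bounded by a fixed power of `Y`, and `a *
Nat.size (n + k)` bits hold everything below `Y ^ a`. -/
theorem exists_fits (c : ℕ) :
    ∃ a, ∀ n k m, 1 ≤ k → m ≤ n * n → Fits (a * Nat.size (n + k)) c n k m := by
  set M := (masks (c + 2)).length with hM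
  -- The highest power of `Y` needed comes from `T ^ (c + 2)`, at most `Y ^ ((c + 4) * (c + 2))`;
  -- the remainder of the exponent absorbs the additive terms, including the number `M` of position
  -- sets.
  refine ⟨(c + 4) * (c + 4) + M + 10, fun n k m hk hm => ?_⟩
  set Y := 2 ^ Nat.size (n + k) with hY
  have hYlt : n + k < Y := Nat.lt_size_self _
  have h2Y : 2 ≤ Y := by omega
  have hpow : ∀ {i j : ℕ}, i ≤ j → Y ^ i ≤ Y ^ j := fun h => Nat.pow_le_pow_right (by omega) h
  -- As `Y ≥ 2`, constants are themselves absorbed by powers of `Y`.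
  have hconst : ∀ q, q ≤ Y ^ q := fun q =>
    (Nat.lt_two_pow_self.le).trans (Nat.pow_le_pow_left h2Y q)
  have hsucc : ∀ i, 2 * Y ^ i ≤ Y ^ (i + 1) := fun i => by
    rw [pow_succ']
    exact Nat.mul_le_mul_right _ h2Y
  have hpos : ∀ i, 0 < Y ^ i := fun i => by positivity
  have hw : 2 ^ (((c + 4) * (c + 4) + M + 10) * Nat.size (n + k)) =
      Y ^ ((c + 4) * (c + 4) + M + 10) := by
    rw [hY, ← pow_mul, mul_comm]
  have hexp : (c + 4) * (c + 4) = c * c + 8 * c + 16 := by ring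
  have e2 : Y ^ 2 = Y * Y := sq Y
  have e1 : Y ^ 1 = Y := pow_one Y
  have hsmall : ∀ i, i + 1 ≤ (c + 4) * (c + 4) + M + 10 →
      2 * Y ^ i ≤ Y ^ ((c + 4) * (c + 4) + M + 10) := fun i hi => (hsucc i).trans (hpow hi)
  have hnn : n * n + n ≤ Y ^ 2 := by
    rw [e2]
    calc n * n + n = n * (n + 1) := by ring
      _ ≤ Y * Y := Nat.mul_le_mul (by omega) (by omega)
  have hcM : c * n + n + M ≤ 2 * Y ^ (c + 2 + M) := by
    have h1 : (c + 1) * n ≤ Y ^ (c + 1) * Y := Nat.mul_le_mul (hconst _) (by omega)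
    have h2 := hconst M
    have h3 : c * n + n = (c + 1) * n := by ring
    have h4 : Y ^ (c + 1) * Y ≤ Y ^ (c + 2 + M) := by
      rw [← pow_succ]
      exact hpow (by omega)
    have h5 : Y ^ M ≤ Y ^ (c + 2 + M) := hpow (by omega)
    omega
  have hck : c + k ≤ Y ^ (c + 2) := by
    have h1 := hconst c
    have h2 : Y ^ c ≤ Y ^ (c + 1) := hpow (by omega)
    have h3 : Y ^ 1 ≤ Y ^ (c + 1) := hpow (by omega)
    have h4 : 2 * Y ^ (c + 1) ≤ Y ^ (c + 2) := hsucc (c + 1)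
    omega
  have hT : ((c + 2) * k + 1) ^ (c + 2) ≤ Y ^ ((c + 4) * (c + 2)) := by
    rw [pow_mul]
    refine Nat.pow_le_pow_left ?_ _
    calc (c + 2) * k + 1 ≤ (c + 3) * Y := by nlinarith
      _ ≤ Y ^ (c + 3) * Y := Nat.mul_le_mul_right _ (hconst _)
      _ = Y ^ (c + 4) := (pow_succ _ _).symm
  have hexp' : (c + 4) * (c + 2) = c * c + 6 * c + 8 := by ring
  constructor <;> rw [hw]
  · have := hsmall 2 (by omega)
    have := hpos 2
    omega
  · have := hsmall 2 (by omega)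
    have := hpos 2
    have : Y ≤ Y * Y := Nat.le_mul_self Y
    omega
  · exact (Nat.pow_le_pow_left (by omega) _).trans (hpow (by omega))
  · have h1 := hsmall ((c + 4) * (c + 2) + M + 1) (by omega)
    have h2 := hsucc ((c + 4) * (c + 2) + M)
    have h3 : Y ^ ((c + 4) * (c + 2)) ≤ Y ^ ((c + 4) * (c + 2) + M) := hpow (by omega)
    have h4 : Y ^ M ≤ Y ^ ((c + 4) * (c + 2) + M) := hpow (by omega)
    have h5 := hconst M
    have h6 := hpos ((c + 4) * (c + 2) + M)
    omega
  · have h1 := hsmall (c + 2 + M + 1) (by omega)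
    have h2 := hsucc (c + 2 + M)
    have h3 := hpos (c + 2 + M)
    omega
  · have h1 := Nat.pow_le_pow_left hck c
    rw [← pow_mul] at h1
    have h2 := hsmall ((c + 2) * c) (by nlinarith)
    have h3 := hpos ((c + 2) * c)
    omega
  · have h1 := hsmall (c + 2) (by omega)
    have h2 := hpos (c + 2)
    omega
  · have h1 := hsmall 4 (by omega)
    have h2 : 2 * Y ^ 2 ≤ Y ^ 3 := hsucc 2
    have h3 : 2 * Y ^ 3 ≤ Y ^ 4 := hsucc 3
    have h4 : 2 * 2 ≤ Y * Y := Nat.mul_le_mul h2Y h2Y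
    omega

theorem IsEdgeList.length_eq {n : ℕ} {G : SimpleGraph (Fin n)} {l : List (Fin n × Fin n)}
    (h : IsEdgeList G l) : l.length = G.edgeSet.ncard := by
  classical
  have hset : G.edgeSet = ↑(l.map fun e => s(e.1, e.2)).toFinset := by
    ext e
    induction e with
    | _ u v => rw [List.coe_toFinset, Set.mem_ofPred_eq, h.2, SimpleGraph.mem_edgeSet]
  rw [hset, Set.ncard_coe_finset, List.toFinset_card_of_nodup h.1, List.length_map]

theorem IsEdgeList.length_le {n : ℕ} {G : SimpleGraph (Fin n)} {l : List (Fin n × Fin n)}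
    (h : IsEdgeList G l) : l.length ≤ n * n := by
  simpa using (List.Nodup.of_map _ h.1).length_le_card

open scoped Classical in
-- Every marked vertex occurs in one of at most `T ^ d` stored tuples, each of which has `d`
-- entries.
theorem card_marked_le {d n T : ℕ} {s : State} {K : Finset (Fin d → Fin n)} (hK : Stored T s K) :
    Nat.count (fun a => s.arr 5 a = 1) n ≤ d * T ^ d := by
  rw [Nat.count_eq_card_filter_range]
  have hsub : (Finset.range n).filter (fun a => s.arr 5 a = 1) ⊆
      K.biUnion fun x => Finset.univ.image fun i => (x i : ℕ) := by
    intro a ha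
    obtain ⟨ha, ha'⟩ := Finset.mem_filter.1 ha
    have := hK.mark ⟨a, Finset.mem_range.1 ha⟩
    rw [ha'] at this
    split_ifs at this with h
    obtain ⟨x, hx, i, hi⟩ := h
    simp only [Finset.mem_biUnion, Finset.mem_image, Finset.mem_univ, true_and]
    exact ⟨x, hx, i, by rw [hi]⟩
  refine (Finset.card_le_card hsub).trans ?_
  refine (Finset.card_biUnion_le_card_mul _ _ d fun x _ => ?_).trans ?_
  · exact Finset.card_image_le.trans (by simp)
  · have := hK.sparse.card_le
    rw [Fintype.card_fin] at this
    rw [mul_comm]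
    exact Nat.mul_le_mul_left _ this

/-- A case distinction on `(c + k) ^ c < n`. If it holds, the number of tuples per pair is below `n`
and the greedy algorithm is cubic; if it fails, the input itself has at most `(c + k) ^ c` vertices
and is returned unchanged. -/
theorem kernel_spec {w c n k : ℕ} (hc0 : c ≠ 0) {G : SimpleGraph (Fin n)}
    {l : List (Fin n × Fin n)} (hl : IsEdgeList G l) (hk : 1 ≤ k) (hw : Fits w c n k l.length) :
    WP w (kernelProg c) (State.init (encode n k l))
      ((tupleTime c + c + 110) * (n ^ 3 + n ^ 2 * l.length + 1)) fun s =>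
      ∃ (n' : ℕ) (G' : SimpleGraph (Fin n')) (l' : List (Fin n' × Fin n')),
        IsEdgeList G' l' ∧ s.Outputs (encode n' k l') ∧ (IsYes c G k ↔ IsYes c G' k) ∧
        n' ≤ (c + 2) * (c + 3) ^ (c + 2) * k ^ (c + 2) := by
  classical
  have hcap := hw.cap
  have hm := hl.length_le
  have hn3 : n * n ≤ n ^ 3 := by
    rw [← sq]
    rcases n.eq_zero_or_pos with rfl | h
    · simp
    · exact Nat.pow_le_pow_right h (by simp)
  have hn1 : n ≤ n * n := Nat.le_mul_self n
  obtain ⟨ok, hc, h8, harr⟩ := setup_spec hw hk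
  set s₁ := runBlock (setupBlock c) (State.init (encode n k l)) with hs₁
  have hin : InputStored l s₁ := by
    unfold InputStored
    rw [harr]
    exact inputStored_init l
  have hzero : ∀ a, a ≠ 0 → ∀ i, s₁.arr a i = 0 := fun a ha i => by
    rw [harr]
    simp [State.init, ha]
  have hlen : (setupBlock c).length = c + 13 := by
    simp [setupBlock, powBlock]
  by_cases hbig : (c + k) ^ c < n
  · have htime : (setupBlock c).length + 1 + ((l.length * 14 + 2) +
        ((n * (n * (pairTime c n ((c + k) ^ c) + 2) + 2 + 2) + 2) +
        (n * 6 + l.length * 19 + 12)) + 1) ≤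
        (tupleTime c + c + 110) * (n ^ 3 + n ^ 2 * l.length + 1) := by
      -- The case assumption replaces the number of tuples by `n`, which makes the time per pair
      -- linear in `n`.
      have h1 : pairTime c n ((c + k) ^ c) ≤ n * (tupleTime c + 14) + c + 20 := by
        have := Nat.mul_le_mul_right (tupleTime c + 2) hbig.le
        unfold pairTime
        linarith
      have h2 : n * (n * (pairTime c n ((c + k) ^ c) + 2) + 2 + 2) ≤
          n * (n * (n * (tupleTime c + 14) + c + 22) + 4) := by
        refine Nat.mul_le_mul_left _ ?_
        have := Nat.mul_le_mul_left n (Nat.add_le_add_right h1 2)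
        simpa only [add_assoc] using Nat.add_le_add_right this 4
      have h3 : n * (n * (n * (tupleTime c + 14) + c + 22) + 4) =
          (tupleTime c + 14) * n ^ 3 + (c + 22) * (n * n) + 4 * n := by ring
      have h4 := Nat.mul_le_mul_left (c + 22) hn3
      have h5 : (tupleTime c + c + 110) * (n ^ 3 + n ^ 2 * l.length + 1) =
          (tupleTime c + 14) * n ^ 3 + (c + 22) * n ^ 3 + 74 * n ^ 3 +
          (tupleTime c + c + 110) * (n ^ 2 * l.length) + tupleTime c + c + 110 := by ring
      have h6 := Nat.zero_le ((tupleTime c + c + 110) * (n ^ 2 * l.length))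
      linarith
    refine (WP.seq (WP.block ok (WP.ite (fun _ => ?_) fun hb => ?_))).mono htime fun _ h => h
    swap
    · simp only [Test.Holds, ← hs₁, h8, hc.verts] at hb
      exact absurd hbig hb
    refine WP.seq ((adjLoop_spec hl hw hc hin (hzero 2 (by simp))).frame.mono le_rfl ?_)
    rintro s₂ ⟨hG, hreg, harr2⟩
    have hc2 : Ctx c n k l.length s₂ := hc.congr fun j hj =>
      hreg j (keepsReg_forLoop.2 ⟨by omega, adjBlock_keepsReg (by omega)⟩)
    have ha2 : ∀ a, a ≠ 2 → s₂.arr a = s₁.arr a := fun a ha =>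
      harr2 a (keepsArr_forLoop.2 (adjBlock_keepsArr ha))
    refine WP.seq ((pairsLoop_spec hw hc2 hG hc0 (by rw [ha2 4 (by simp)]; exact hzero 4 (by simp))
      (by rw [ha2 5 (by simp)]; exact hzero 5 (by simp))).frame.mono le_rfl ?_)
    rintro s₃ ⟨⟨K, hK, hforb, hpairs⟩, hreg3, harr3⟩
    have hc3 : Ctx c n k l.length s₃ := hc2.congr fun j hj =>
      hreg3 j (pairsLoop_keepsReg (by omega))
    have hin3 : InputStored l s₃ := by
      unfold InputStored
      rw [harr3 0 (pairsLoop_keepsArr (by simp) (by simp) (by simp)), ha2 0 (by simp)]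
      exact hin
    refine (outputProg_spec hl hw hc3 (by omega) hin3 fun a ha => ?_).mono le_rfl ?_
    · rw [hK.mark ⟨a, ha⟩]
      split_ifs <;> simp
    · rintro s₄ ⟨e, he, l', hl', hout⟩
      refine ⟨_, _, l', hl', hout, isYes_comap_iff (Nat.pos_of_ne_zero hc0) hK.sparse hforb hpairs e
        fun x hx i => he _ ?_, (card_marked_le hK).trans ?_⟩
      · rw [hK.mark, if_pos ⟨x, hx, i, rfl⟩]
      · rw [mul_assoc, ← mul_pow]
        refine Nat.mul_le_mul_left _ (Nat.pow_le_pow_left ?_ _)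
        nlinarith
  -- Copying is linear in the number of edges, which is at most `n * n` and hence at most `n ^ 3`.
  · have htime : (setupBlock c).length + 1 + (l.length * 10 + 20 + 1) ≤
        (tupleTime c + c + 110) * (n ^ 3 + n ^ 2 * l.length + 1) := by
      have h5 : (tupleTime c + c + 110) * (n ^ 3 + n ^ 2 * l.length + 1) =
          (tupleTime c + c + 100) * n ^ 3 + 10 * n ^ 3 +
          (tupleTime c + c + 110) * (n ^ 2 * l.length) + tupleTime c + c + 110 := by ring
      have h6 := Nat.zero_le ((tupleTime c + c + 110) * (n ^ 2 * l.length))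
      have h7 := Nat.zero_le ((tupleTime c + c + 100) * n ^ 3)
      linarith
    refine (WP.seq (WP.block ok (WP.ite (fun hb => ?_) fun _ => ?_))).mono htime fun _ h => h
    · simp only [Test.Holds, ← hs₁, h8, hc.verts] at hb
      exact absurd hb hbig
    refine (copyProg_spec hw hc fun a ha => ?_).mono le_rfl ?_
    · have hlt : a < (encode n k l).length := by rwa [length_encode]
      have hmem : ∀ x ∈ encode n k l, x < 2 ^ w := by
        simp only [encode, List.mem_cons, List.mem_flatMap]
        rintro x (rfl | rfl | rfl | ⟨e, -, rfl | rfl | h⟩)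
        · have := hw.succ
          omega
        · omega
        · have := hw.edges
          omega
        · have := hw.succ
          have := e.1.isLt
          omega
        · have := hw.succ
          have := e.2.isLt
          omega
        · simp at h
      rw [harr]
      simpa [State.init, hlt] using hmem _ (List.getElem_mem hlt)
    · intro s hs
      refine ⟨n, G, l, hl, fun i hi => ?_, Iff.rfl, ?_⟩
      · rw [hs i (by rwa [length_encode] at hi), harr]
        simp [State.init, hi]
      · have h1 : c + k ≤ (c + 3) * k := by nlinarith
        calc n ≤ (c + k) ^ c := not_lt.1 hbig
          _ ≤ ((c + 3) * k) ^ c := Nat.pow_le_pow_left h1 c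
          _ ≤ ((c + 3) * k) ^ (c + 2) := Nat.pow_le_pow_right (by positivity) (by omega)
          _ = 1 * ((c + 3) ^ (c + 2) * k ^ (c + 2)) := by rw [mul_pow, one_mul]
          _ ≤ _ := by
            rw [mul_assoc]
            exact Nat.mul_le_mul_right _ (by omega)

end CVD

theorem mainTheorem2 (c : ℕ) (hc : 2 ≤ c) :
    ∃ (P : WordRAM.Prog) (a C : ℕ),
      CVD.IsKernelization c P a (fun k => C * k ^ (c + 2))
        (fun n m => C * (n ^ 3 + n ^ 2 * m + 1)) := by
  obtain ⟨a, ha⟩ := CVD.exists_fits c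
  -- A single constant has to serve both bounds, so the size constant and the time constant are
  -- added.
  refine ⟨CVD.kernelProg c, a, (c + 2) * (c + 3) ^ (c + 2) + (CVD.tupleTime c + c + 110), ?_⟩
  intro n G k l hk hl
  obtain ⟨s, t, he, ht, n', G', l', hl', hout, hyes, hn'⟩ :=
    CVD.kernel_spec (by omega) hl hk (ha n k l.length hk hl.length_le)
  refine ⟨s, t, he, ht.trans ?_, n', G', k, l', hk, hl', hout, hyes, hn'.trans ?_, le_rfl⟩
  · rw [hl.length_eq]
    exact Nat.mul_le_mul_right _ (Nat.le_add_left _ _)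
  · exact Nat.mul_le_mul_right _ (Nat.le_add_right _ _)
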